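/- Let $D\ge 2$ and let $K$ be a compact Hausdorff smooth manifold of dimension $D-2$ without boundary. Let the spacetime $M$ be an open subset of $\mathbb R\times\mathbb R\times K$ with points $(t,\rho,\sigma)$. A chart $\sigma^2,\dots,\sigma^{D-1}$ of $K$ gives local coordinates $y=(t,\rho,\sigma^2,\dots,\sigma^{D-1})$, with indices $0=t$, $1=\rho$, $M=2,\dots,D-1$. Put $\mathcal H=\{p\in M:\rho(p)=0\}$ and $M_+=\{p\in M:\rho(p)>0\}$. The surface $\Sigma_t$ is the part $t=\mathrm{const}$ of $M_+$, and its boundary is $\partial\Sigma_t=\{t\}\times\{0\}\times K$. Let $\bar g$ be a smooth Lorentzian metric on $M_+$ (it may degenerate or blow up at $\mathcal H$). For a Lorentzian metric $g$ and symmetric tensor fields $\delta_1 g,\delta_2 g$ let $$\omega^{\nu}(g,\delta_1g,\delta_2g)=\frac{\sqrt{-g}}{16\pi G}\Big(g^{\nu\alpha}\big(g^{\rho\sigma}g^{\beta\gamma}-2g^{\rho\beta}g^{\sigma\gamma}\big)+2g^{\nu\gamma}g^{\rho[\alpha}g^{\sigma]\beta}+g^{\nu\rho}g^{\alpha\beta}g^{\sigma\gamma}\Big)\,\delta_{[1}g_{\rho\sigma}\nabla_\gamma\delta_{2]}g_{\alpha\beta}$$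 be the pre-symplectic current of general relativity, where $G>0$, brackets denote antisymmetrization with weight one, and $\nabla$ is the Levi-Civita connection of $g$. Let $\mathcal A$ be a Lie algebra of smooth vector fields on $M$. A diffeomorphism of $M$ is *generated by $\mathcal A$* if it is a finite composition of time-one maps of global flows on $M$ of elements of $\mathcal A$. Assume that $\mathcal A$ is stable under push-forward by the diffeomorphisms that it generates, and let $\mathcal S=\{\phi^*\bar g:\phi \text{ generated by }\mathcal A\}$. We say that components $V^\mu$ are $(O(1),O(\rho),O(1),\dots,O(1))$ as $\rho\to0$ if every point of $\mathcal H$ has, in each of the above coordinate systems around it, a neighbourhood and a constant $C$ such that $|V^\rho|\le C\rho$, $|V^t|\le C$ and $|V^M|\le C$ on the part of the neighbourhood where $\rho>0$. Suppose that 1. for every $\xi\in\mathcal A$, the components $\xi^\mu$ are $(O(1),O(\rho),O(1),\dots,O(1))$ as $\rho\to0$; 2. for all $\eta,\chi\in\mathcal A$, the components $\omega^\mu(\bar g,\pounds_\eta\bar g,\pounds_\chi\bar g)$ are $(O(1),O(\rho),O(1),\dots,O(1))$ as $\rho\to0$. Then the integrability condition holds at every metric of $\mathcal S$: for all $g\in\mathcal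 S$, all $\xi,\eta,\chi\in\mathcal A$ and every $t$ with $\{t\}\times\{0\}\times K\subset M$, $$\oint_{\partial\Sigma_t}(d^{D-2}x)_{\mu\nu}\,\xi^{[\mu}\omega^{\nu]}(g,\pounds_\eta g,\pounds_\chi g)\;:=\;\lim_{\rho\to0^+}\int_{\{t\}\times\{\rho\}\times K}(d^{D-2}x)_{\mu\nu}\,\xi^{[\mu}\omega^{\nu]}(g,\pounds_\eta g,\pounds_\chi g)=0 ,$$ where $(d^{D-2}x)_{\mu\nu}=\frac{1}{2!(D-2)!}\,\epsilon_{\mu\nu\alpha_2\cdots\alpha_{D-1}}\,dx^{\alpha_2}\wedge\cdots\wedge dx^{\alpha_{D-1}}$ with the Levi-Civita symbol $\epsilon_{01\cdots D-1}=1$. (As $\omega$ is a vector density, the integrand is a density on $K$, and no orientation of $K$ is needed.) -/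

import Mathlib

open Set Filter Topology MeasureTheory Manifold Asymptotics
open scoped ContDiff

noncomputable section

namespace CovPhase

/-! ### Tensor calculus in coordinates

A tensor field on a coordinate domain is given by its component functions of
`y : Fin n → ℝ`. -/

section Coordinates

variable {n : ℕ}

/-- The partial derivative `∂_μ f`. -/
def pd (μ : Fin n) (f : (Fin n → ℝ) → ℝ) (y : Fin n → ℝ) : ℝ :=
  fderiv ℝ f y (Pi.single μ 1)

/-- The Christoffel symbols `Γ^l_{μν}` of the metric `g`. -/
def christoffel (g : (Fin n → ℝ) → Matrix (Fin n) (Fin n) ℝ) (l μ ν : Fin n)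
    (y : Fin n → ℝ) : ℝ :=
  (1 / 2) * ∑ κ, (g y)⁻¹ l κ *
    (pd μ (fun z => g z κ ν) y + pd ν (fun z => g z κ μ) y - pd κ (fun z => g z μ ν) y)

/-- The covariant derivative `∇_γ h_{αβ}` of a two-tensor for the Levi-Civita connection of `g`. -/
def covDeriv (g h : (Fin n → ℝ) → Matrix (Fin n) (Fin n) ℝ) (γ α β : Fin n)
    (y : Fin n → ℝ) : ℝ :=
  pd γ (fun z => h z α β) y
    - ∑ l, christoffel g l γ α y * h y l β
    - ∑ l, christoffel g l γ β y * h y α l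

/-- The Lie derivative `(£_ξ g)_{μν} = ξ^α ∂_α g_{μν} + g_{αν} ∂_μ ξ^α + g_{μα} ∂_ν ξ^α`. -/
def lieMetric (ξ : (Fin n → ℝ) → Fin n → ℝ) (g : (Fin n → ℝ) → Matrix (Fin n) (Fin n) ℝ)
    (y : Fin n → ℝ) : Matrix (Fin n) (Fin n) ℝ :=
  Matrix.of fun μ ν => ∑ α, (ξ y α * pd α (fun z => g z μ ν) y
    + g y α ν * pd μ (fun z => ξ z α) y + g y μ α * pd ν (fun z => ξ z α) y)

/-- The pre-symplectic current `ω^ν(g, δ₁g, δ₂g)` of the Einstein-Hilbert Lagrangian, a vector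
density, where `h₁ = δ₁g`, `h₂ = δ₂g` and `G` is Newton's constant.  With `i = g⁻¹`,

`ω^ν = √(-g)/(16πG) (i^{να}(i^{ρσ} i^{βγ} - 2 i^{ρβ} i^{σγ}) + 2 i^{νγ} i^{ρ[α} i^{σ]β}
  + i^{νρ} i^{αβ} i^{σγ}) δ_{[1} g_{ρσ} ∇_γ δ_{2]} g_{αβ}`. -/
def symplecticCurrent (G : ℝ) (g h₁ h₂ : (Fin n → ℝ) → Matrix (Fin n) (Fin n) ℝ)
    (y : Fin n → ℝ) (ν : Fin n) : ℝ :=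
  let i := (g y)⁻¹
  Real.sqrt (-(g y).det) / (16 * Real.pi * G) *
    ∑ α, ∑ β, ∑ γ, ∑ ρ, ∑ σ,
      (i ν α * (i ρ σ * i β γ - 2 * i ρ β * i σ γ)
        + i ν γ * (i ρ α * i σ β - i ρ σ * i α β)
        + i ν ρ * i α β * i σ γ)
      * ((1 / 2) * (h₁ y ρ σ * covDeriv g h₂ γ α β y - h₂ y ρ σ * covDeriv g h₁ γ α β y))

/-- The Levi-Civita symbol `ε_{s 0, …, s (n-1)}`, normalised by `ε_{0 1 … n-1} = 1`. -/
def leviCivita (s : Fin n → Fin n) : ℝ :=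
  Matrix.det (Matrix.of fun i j : Fin n => if s i = j then (1 : ℝ) else 0)

/-- The coefficient of `dσ² ∧ … ∧ dσ^{D-1}` in the pull-back of
`(d^{D-2}x)_{μν} = ε_{μν α₂ … α_{D-1}} / (2! (D-2)!) dx^{α₂} ∧ … ∧ dx^{α_{D-1}}`, `D = m + 2`,
to a surface on which `x⁰` and `x¹` are constant; the determinant is the value of
`dx^{α₂} ∧ … ∧ dx^{α_{D-1}}` on `(∂₂, …, ∂_{D-1})`. -/
def surfaceElement (m : ℕ) (μ ν : Fin (m + 2)) : ℝ :=
  ∑ α : Fin m → Fin (m + 2),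
    leviCivita (Fin.cons μ (Fin.cons ν α : Fin (m + 1) → Fin (m + 2)) : Fin (m + 2) → Fin (m + 2))
      / (Nat.factorial 2 * Nat.factorial m)
      * Matrix.det (Matrix.of fun i j : Fin m => if α i = j.succ.succ then (1 : ℝ) else 0)

end Coordinates

/-! ### The spacetime

`K` is the closed `(D-2)`-dimensional cross section of the boundary, `D = m + 2`.  The spacetime is
an open subset `M` of `ℝ × ℝ × K`, whose points are written `p = (t, ρ, σ)`.  The surface `Σ_t` is
`{t} × {ρ > 0}`, and its boundary `∂Σ_t` is `{t} × {0} × K`. -/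

section Spacetime

variable {m : ℕ} (K : Type*) [TopologicalSpace K] [ChartedSpace (EuclideanSpace ℝ (Fin m)) K]

/-- The ambient space `ℝ × ℝ × K` of points `(t, ρ, σ)`. -/
abbrev Spc (K : Type*) : Type _ := ℝ × ℝ × K

/-- The model with corners of `ℝ × ℝ × K`. -/
abbrev Mdl (m : ℕ) : ModelWithCorners ℝ (ℝ × ℝ × EuclideanSpace ℝ (Fin m))
    (ModelProd ℝ (ModelProd ℝ (EuclideanSpace ℝ (Fin m)))) :=
  𝓘(ℝ, ℝ).prod (𝓘(ℝ, ℝ).prod (𝓡 m))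

/-- Vector fields; only their values on the spacetime `M` matter. -/
abbrev VField (m : ℕ) (K : Type*) [TopologicalSpace K]
    [ChartedSpace (EuclideanSpace ℝ (Fin m)) K] : Type _ :=
  (p : Spc K) → TangentSpace (Mdl m) p

/-- Fields of bilinear forms on the tangent spaces. -/
abbrev BField (m : ℕ) (K : Type*) [TopologicalSpace K]
    [ChartedSpace (EuclideanSpace ℝ (Fin m)) K] : Type _ :=
  (p : Spc K) → (TangentSpace (Mdl m) p →ₗ[ℝ] TangentSpace (Mdl m) p →ₗ[ℝ] ℝ)

variable {K}

/-- The coordinate system `(t, ρ, σ²,…, σ^{D-1})` given by a chart `e` of `K`. -/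
def coordMap (e : OpenPartialHomeomorph K (EuclideanSpace ℝ (Fin m))) (p : Spc K) :
    Fin (m + 2) → ℝ :=
  Fin.cons p.1 (Fin.cons p.2.1 (fun i => e p.2.2 i : Fin m → ℝ) : Fin (m + 1) → ℝ)

/-- The last `D - 2` coordinates. -/
def angular (y : Fin (m + 2) → ℝ) : EuclideanSpace ℝ (Fin m) :=
  WithLp.toLp 2 fun i : Fin m => y i.succ.succ

/-- The inverse of the coordinate system `coordMap e`. -/
def coordInv (e : OpenPartialHomeomorph K (EuclideanSpace ℝ (Fin m))) (y : Fin (m + 2) → ℝ) :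
    Spc K :=
  (y 0, y 1, e.symm (angular y))

/-- The coordinate image of the part of `W` covered by the chart `e`. -/
def coordDomain (e : OpenPartialHomeomorph K (EuclideanSpace ℝ (Fin m))) (W : Set (Spc K)) :
    Set (Fin (m + 2) → ℝ) :=
  {y | angular y ∈ e.target ∧ coordInv e y ∈ W}

/-- The components `ξ^μ(y)` of a vector field. -/
def vecComp (e : OpenPartialHomeomorph K (EuclideanSpace ℝ (Fin m))) (ξ : VField m K)
    (y : Fin (m + 2) → ℝ) : Fin (m + 2) → ℝ :=
  mfderiv (Mdl m) 𝓘(ℝ, Fin (m + 2) → ℝ) (coordMap e) (coordInv e y) (ξ (coordInv e y))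

/-- The coordinate vector field `∂_μ` at the point with coordinates `y`. -/
def coordVec (e : OpenPartialHomeomorph K (EuclideanSpace ℝ (Fin m))) (y : Fin (m + 2) → ℝ)
    (μ : Fin (m + 2)) : TangentSpace (Mdl m) (coordInv e y) :=
  mfderiv 𝓘(ℝ, Fin (m + 2) → ℝ) (Mdl m) (coordInv e) y (Pi.single μ (1 : ℝ) : Fin (m + 2) → ℝ)

/-- The components `g_{μν}(y) = g(∂_μ, ∂_ν)`. -/
def metricComp (e : OpenPartialHomeomorph K (EuclideanSpace ℝ (Fin m))) (g : BField m K)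
    (y : Fin (m + 2) → ℝ) : Matrix (Fin (m + 2)) (Fin (m + 2)) ℝ :=
  Matrix.of fun μ ν => g (coordInv e y) (coordVec e y μ) (coordVec e y ν)

/-- The components `ω^ν(g, £_η g, £_χ g; y)`. -/
def omegaComp (G : ℝ) (e : OpenPartialHomeomorph K (EuclideanSpace ℝ (Fin m)))
    (g : BField m K) (η χ : VField m K) (y : Fin (m + 2) → ℝ) : Fin (m + 2) → ℝ :=
  symplecticCurrent G (metricComp e g) (lieMetric (vecComp e η) (metricComp e g))
    (lieMetric (vecComp e χ) (metricComp e g)) y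

/-- `g` is a smooth metric of signature `(-, +, …, +)` on the open set `W`. -/
structure IsLorentzMetric (W : Set (Spc K)) (g : BField m K) : Prop where
  smooth : ∀ e ∈ atlas (EuclideanSpace ℝ (Fin m)) K, ∀ μ ν : Fin (m + 2),
    ContDiffOn ℝ ∞ (fun y => metricComp e g y μ ν) (coordDomain e W)
  lorentzian : ∀ p ∈ W, ∃ b : Module.Basis (Fin (m + 2)) ℝ (TangentSpace (Mdl m) p),
    ∀ i j, g p (b i) (b j) = if i = j then (if i = 0 then -1 else 1) else 0

/-- The region `ρ > 0` of the spacetime, whose slices are the surfaces `Σ_t`. -/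
def inside (M : Set (Spc K)) : Set (Spc K) := {p ∈ M | 0 < p.2.1}

/-- The behaviour `(O(1), O(ρ), O(1), …, O(1))` as `ρ → 0`, locally uniformly along
`𝓗 = {p ∈ M | ρ(p) = 0}`, of the components `V e y μ` in the coordinate systems given by the
charts `e` of `K`. -/
def BoundaryOrder (M : Set (Spc K))
    (V : OpenPartialHomeomorph K (EuclideanSpace ℝ (Fin m)) →
      (Fin (m + 2) → ℝ) → Fin (m + 2) → ℝ) : Prop :=
  ∀ e ∈ atlas (EuclideanSpace ℝ (Fin m)) K, ∀ h ∈ M, h.2.1 = 0 → h.2.2 ∈ e.source →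
    ∀ μ : Fin (m + 2),
      (fun p : Spc K => V e (coordMap e p) μ) =O[𝓝[inside M] h]
        (fun p : Spc K => if μ = 1 then p.2.1 else 1)

/-- `𝒜` is a Lie algebra of smooth vector fields on `M`. -/
structure IsLieAlgebraOfFields [IsManifold (𝓡 m) ∞ K] (M : Set (Spc K)) (𝒜 : Submodule ℝ (VField m K)) : Prop where
  smooth : ∀ ξ ∈ 𝒜, ContMDiffOn (Mdl m) (Mdl m).tangent ∞
    (fun p => (⟨p, ξ p⟩ : TangentBundle (Mdl m) (Spc K))) M
  bracket : ∀ ξ ∈ 𝒜, ∀ η ∈ 𝒜, ∃ ζ ∈ 𝒜,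
    ∀ p ∈ M, ζ p = VectorField.mlieBracket (Mdl m) ξ η p

/-- `φ` is the (smooth, globally defined) flow on `M` of the vector field `ξ`. -/
structure IsFlow (M : Set (Spc K)) (ξ : VField m K) (φ : ℝ → Spc K → Spc K) : Prop where
  smooth : ContMDiffOn (𝓘(ℝ, ℝ).prod (Mdl m)) (Mdl m) ∞
    (fun q : ℝ × Spc K => φ q.1 q.2) (univ ×ˢ M)
  mapsTo : ∀ s, MapsTo (φ s) M M
  zero : ∀ p ∈ M, φ 0 p = p
  add : ∀ s r, ∀ p ∈ M, φ (s + r) p = φ s (φ r p)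
  integralCurve : ∀ p ∈ M, IsMIntegralCurve (fun s => φ s p) ξ

/-- The diffeomorphisms of `M` generated by `𝒜`: the finite products
`φ_{ξ⁽¹⁾} ∘ … ∘ φ_{ξ⁽ᴺ⁾}` of time-one maps of flows of elements of `𝒜`. -/
inductive Generated (M : Set (Spc K)) (𝒜 : Submodule ℝ (VField m K)) :
    (Spc K → Spc K) → Prop
  | id : Generated M 𝒜 id
  | comp {ξ : VField m K} {φ : ℝ → Spc K → Spc K} {ψ : Spc K → Spc K} :
      ξ ∈ 𝒜 → IsFlow M ξ φ → Generated M 𝒜 ψ → Generated M 𝒜 (φ 1 ∘ ψ)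

/-- `𝒜` is stable under push-forward by the diffeomorphisms that it generates. -/
def AdjointInvariant (M : Set (Spc K)) (𝒜 : Submodule ℝ (VField m K)) : Prop :=
  ∀ φ, Generated M 𝒜 φ → ∀ ξ ∈ 𝒜, ∃ ζ ∈ 𝒜,
    ∀ p ∈ M, ζ (φ p) = mfderiv (Mdl m) (Mdl m) φ p (ξ p)

/-- The pull-back `φ^* g`. -/
def pullbackMetric (φ : Spc K → Spc K) (g : BField m K) : BField m K := fun p =>
  (g (φ p)).compl₁₂ (mfderiv (Mdl m) (Mdl m) φ p).toLinearMap
    (mfderiv (Mdl m) (Mdl m) φ p).toLinearMap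

/-- The set `𝒮 = {φ^* ḡ | φ a diffeomorphism generated by 𝒜}`. -/
def orbit (M : Set (Spc K)) (𝒜 : Submodule ℝ (VField m K)) (gbar : BField m K) :
    Set (BField m K) :=
  {g | ∃ φ, Generated M 𝒜 φ ∧ g = pullbackMetric φ gbar}

/-- A finite partition of unity on `K` whose members are supported in charts, used to
integrate over `K`. -/
structure ChartPartition (m : ℕ) (K : Type*) [TopologicalSpace K]
    [ChartedSpace (EuclideanSpace ℝ (Fin m)) K] where
  size : ℕ
  weight : PartitionOfUnity (Fin size) K
  chart : Fin size → OpenPartialHomeomorph K (EuclideanSpace ℝ (Fin m))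
  chart_mem : ∀ i, chart i ∈ atlas (EuclideanSpace ℝ (Fin m)) K
  subordinate : ∀ i, tsupport (weight i) ⊆ (chart i).source

/-- Such partitions exist on compact manifolds. -/
theorem ChartPartition.nonempty [CompactSpace K] [T2Space K] : Nonempty (ChartPartition m K) := by
  obtain ⟨t, ht⟩ := isCompact_univ.elim_finite_subcover
    (fun x : K => (chartAt (EuclideanSpace ℝ (Fin m)) x).source)
    (fun x => (chartAt (EuclideanSpace ℝ (Fin m)) x).open_source)
    (fun x _ => mem_iUnion.2 ⟨x, mem_chart_source _ x⟩)
  let c : Fin t.card → K := fun i => (t.equivFin.symm i : K)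
  obtain ⟨f, hf⟩ := PartitionOfUnity.exists_isSubordinate (isClosed_univ (X := K))
    (fun i : Fin t.card => (chartAt (EuclideanSpace ℝ (Fin m)) (c i)).source)
    (fun i => (chartAt (EuclideanSpace ℝ (Fin m)) (c i)).open_source)
    (fun x hx => by
      obtain ⟨z, hz, hxz⟩ := mem_iUnion₂.1 (ht hx)
      exact mem_iUnion.2 ⟨t.equivFin ⟨z, hz⟩, by simpa [c] using hxz⟩)
  exact ⟨⟨t.card, f, fun i => chartAt _ (c i), fun i => chart_mem_atlas _ _, hf⟩⟩

/-- The integral `∮ (d^{D-2}x)_{μν} ξ^{[μ} ω^{ν]}(g, £_η g, £_χ g; x)` over the closed surface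
`{t} × {ρ} × K`.  As `ω` is a vector density, the integrand transforms under changes of the
coordinates `σ` as a density on `K`, so neither an orientation of `K` nor the choice of the
partition of unity matters. -/
def surfaceIntegral (P : ChartPartition m K) (G : ℝ) (g : BField m K) (ξ η χ : VField m K)
    (t ρ : ℝ) : ℝ :=
  ∑ i, ∫ x in (P.chart i).target, P.weight i ((P.chart i).symm x) *
    ∑ μ, ∑ ν, surfaceElement m μ ν *
      (let y := coordMap (P.chart i) (t, ρ, (P.chart i).symm x)
       (1 / 2) * (vecComp (P.chart i) ξ y μ * omegaComp G (P.chart i) g η χ y ν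
        - vecComp (P.chart i) ξ y ν * omegaComp G (P.chart i) g η χ y μ))

/-- The integrability condition at `g`: for all `ξ, η, χ ∈ 𝒜` the integral of
`ξ^{[μ} ω^{ν]}(g, £_η g, £_χ g)` over the boundary `∂Σ_t` vanishes, for every `t` for which
`∂Σ_t` lies in `M`.  Since `g` is defined for `ρ > 0` only, the integral over `∂Σ_t` is the limit
`ρ → 0` of the integrals over the surfaces `{t} × {ρ} × K`. -/
def IntegrabilityCondition (M : Set (Spc K)) (G : ℝ) (𝒜 : Submodule ℝ (VField m K))
    (g : BField m K) : Prop :=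
  ∀ ξ ∈ 𝒜, ∀ η ∈ 𝒜, ∀ χ ∈ 𝒜, ∀ t : ℝ, (∀ σ : K, ((t, 0, σ) : Spc K) ∈ M) →
    ∀ P : ChartPartition m K,
      Tendsto (fun ρ => surfaceIntegral P G g ξ η χ t ρ) (𝓝[>] 0) (𝓝 0)

end Spacetime

end CovPhase

end

/-! On a surface of constant `t` and `ρ` only the index pairs `(0,1)` and `(1,0)` of the surface
element survive, so the integrand is a multiple of `ξ^t ω^ρ - ξ^ρ ω^t`. If `ξ` and `ω` both behave
as `(O(1), O(ρ), O(1), …)`, each product carries one factor `O(ρ)`; compactness of `K` makes the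
bound uniform and the integral tends to zero (`BoundaryOrder.contraction_isBigO`,
`tendsto_surfaceIntegral`). What must be shown is that the assumption on `ω`, made at `ḡ` only,
propagates to every `φ^* ḡ`.

The propagation rests on naturality. With `η' = φ_* η` and `χ' = φ_* χ`, which lie in `𝒜` by its
stability under push-forward, the current of `φ^* ḡ` for `η, χ` is the pull-back, as a vector
density, of the current of `ḡ` for `η', χ'`. Since everything is defined by components, this is
proved by hand: the Levi-Civita derivative, the Lie derivative and the contraction with the inverse
metric are each covariant (`covMat_pullMat`, `lieMetric_pullMat`, `currentTensor_contract`), which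
gives `omegaComp_pullbackMetric`.

It remains that pulling back a density by `φ` keeps the orders in `ρ`. Fields of `𝒜` are tangent to
`ρ = 0`, so by a Grönwall argument their flows preserve both `ρ = 0` and `ρ > 0`
(`IsFlow.isAdaptedDiffeo`). Hence `φ^ρ` and its derivatives along the boundary are `O(ρ)`, so the
Jacobian mixes no `O(1)` component into the `ρ` component at leading order
(`isBigO_of_density_transform`). -/

open scoped Matrix

noncomputable section

namespace CovPhase

/-! ### Tensor calculus under a change of coordinates -/

section Covariance

variable {n : ℕ}

/-- The Jacobian matrix `∂_μ Φ^a`. -/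
def jac (Φ : (Fin n → ℝ) → Fin n → ℝ) (y : Fin n → ℝ) : Matrix (Fin n) (Fin n) ℝ :=
  Matrix.of fun a μ => fderiv ℝ Φ y (Pi.single μ 1) a

/-- The entrywise directional derivative of a matrix field. -/
def dirDeriv (h : (Fin n → ℝ) → Matrix (Fin n) (Fin n) ℝ) (y w : Fin n → ℝ) :
    Matrix (Fin n) (Fin n) ℝ :=
  Matrix.of fun α β => fderiv ℝ (fun z => h z α β) y w

/-- Entrywise differentiability of a matrix field. -/
def EntryDiffAt (h : (Fin n → ℝ) → Matrix (Fin n) (Fin n) ℝ) (y : Fin n → ℝ) : Prop :=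
  ∀ i j, DifferentiableAt ℝ (fun z => h z i j) y

theorem EntryDiffAt.mul {A B : (Fin n → ℝ) → Matrix (Fin n) (Fin n) ℝ} {y : Fin n → ℝ}
    (hA : EntryDiffAt A y) (hB : EntryDiffAt B y) : EntryDiffAt (fun z => A z * B z) y := by
  intro i j
  simp only [Matrix.mul_apply]
  exact DifferentiableAt.fun_sum fun k _ => (hA i k).mul (hB k j)

theorem EntryDiffAt.transpose {A : (Fin n → ℝ) → Matrix (Fin n) (Fin n) ℝ} {y : Fin n → ℝ}
    (hA : EntryDiffAt A y) : EntryDiffAt (fun z => (A z)ᵀ) y := fun i j => hA j i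

theorem EntryDiffAt.comp {A : (Fin n → ℝ) → Matrix (Fin n) (Fin n) ℝ}
    {Φ : (Fin n → ℝ) → Fin n → ℝ} {y : Fin n → ℝ}
    (hA : EntryDiffAt A (Φ y)) (hΦ : DifferentiableAt ℝ Φ y) :
    EntryDiffAt (fun z => A (Φ z)) y :=
  fun i j => DifferentiableAt.comp y (hA i j) hΦ

theorem dirDeriv_mul {A B : (Fin n → ℝ) → Matrix (Fin n) (Fin n) ℝ} {y : Fin n → ℝ}
    (hA : EntryDiffAt A y) (hB : EntryDiffAt B y) (w : Fin n → ℝ) :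
    dirDeriv (fun z => A z * B z) y w = dirDeriv A y w * B y + A y * dirDeriv B y w := by
  ext i j
  have e2 := fderiv_fun_sum (u := Finset.univ) fun k _ => (hA i k).fun_mul (hB k j)
  simp only [dirDeriv, Matrix.mul_apply, Matrix.of_apply, Matrix.add_apply]
  rw [e2, ← Finset.sum_add_distrib, sum_apply]
  refine Finset.sum_congr rfl fun k _ => ?_
  rw [fderiv_fun_mul (hA i k) (hB k j)]
  simp only [add_apply, smul_apply, smul_eq_mul]
  ring

theorem dirDeriv_transpose (A : (Fin n → ℝ) → Matrix (Fin n) (Fin n) ℝ) (y w : Fin n → ℝ) :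
    dirDeriv (fun z => (A z)ᵀ) y w = (dirDeriv A y w)ᵀ := rfl

theorem jac_mulVec (Φ : (Fin n → ℝ) → Fin n → ℝ) (y w : Fin n → ℝ) :
    jac Φ y *ᵥ w = fderiv ℝ Φ y w := by
  have : jac Φ y = LinearMap.toMatrix' (fderiv ℝ Φ y).toLinearMap := by
    ext a μ
    simp [jac, LinearMap.toMatrix'_apply]
  rw [this, LinearMap.toMatrix'_mulVec]
  rfl

theorem dirDeriv_comp {A : (Fin n → ℝ) → Matrix (Fin n) (Fin n) ℝ}
    {Φ : (Fin n → ℝ) → Fin n → ℝ} {y : Fin n → ℝ}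
    (hA : EntryDiffAt A (Φ y)) (hΦ : DifferentiableAt ℝ Φ y) (w : Fin n → ℝ) :
    dirDeriv (fun z => A (Φ z)) y w = dirDeriv A (Φ y) (jac Φ y *ᵥ w) := by
  ext i j
  simp only [dirDeriv, Matrix.of_apply, jac_mulVec]
  have := fderiv_comp y (hA i j) hΦ
  simp only [Function.comp_def] at this
  rw [this]
  rfl

theorem dirDeriv_congr {A B : (Fin n → ℝ) → Matrix (Fin n) (Fin n) ℝ} {y : Fin n → ℝ}
    (h : A =ᶠ[𝓝 y] B) (w : Fin n → ℝ) : dirDeriv A y w = dirDeriv B y w := by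
  ext i j
  simp only [dirDeriv, Matrix.of_apply]
  have e : (fun z => A z i j) =ᶠ[𝓝 y] fun z => B z i j := h.mono fun z hz => by simp only [hz]
  rw [e.fderiv_eq]

theorem dirDeriv_add (A : (Fin n → ℝ) → Matrix (Fin n) (Fin n) ℝ) (y v w : Fin n → ℝ) :
    dirDeriv A y (v + w) = dirDeriv A y v + dirDeriv A y w := by
  ext i j; simp [dirDeriv]

theorem dirDeriv_smul (A : (Fin n → ℝ) → Matrix (Fin n) (Fin n) ℝ) (y w : Fin n → ℝ) (c : ℝ) :
    dirDeriv A y (c • w) = c • dirDeriv A y w := by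
  ext i j; simp [dirDeriv]

theorem jac_apply_eq {Φ : (Fin n → ℝ) → Fin n → ℝ} {y : Fin n → ℝ}
    (hΦ : DifferentiableAt ℝ Φ y) (a μ : Fin n) : jac Φ y a μ = pd μ (fun z => Φ z a) y := by
  simp only [jac, pd, Matrix.of_apply]
  rw [fderiv_apply hΦ a]
  rfl

theorem entryDiffAt_jac {Φ : (Fin n → ℝ) → Fin n → ℝ} {y : Fin n → ℝ}
    (hΦ : ContDiffAt ℝ 2 Φ y) : EntryDiffAt (jac Φ) y := by
  intro a μ
  have h : DifferentiableAt ℝ (fderiv ℝ Φ) y :=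
    (hΦ.fderiv_right (m := 1) (by norm_num)).differentiableAt (by norm_num)
  have h2 : DifferentiableAt ℝ (fun z => fderiv ℝ Φ z (Pi.single μ 1)) y :=
    h.clm_apply (differentiableAt_const _)
  exact differentiableAt_pi.1 h2 a

theorem dirDeriv_jac_mulVec {Φ : (Fin n → ℝ) → Fin n → ℝ} {y : Fin n → ℝ}
    (hΦ : ContDiffAt ℝ 2 Φ y) (w v : Fin n → ℝ) :
    dirDeriv (jac Φ) y w *ᵥ v = fderiv ℝ (fderiv ℝ Φ) y w v := by
  have h : DifferentiableAt ℝ (fderiv ℝ Φ) y :=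
    (hΦ.fderiv_right (m := 1) (by norm_num)).differentiableAt (by norm_num)
  have h1 : dirDeriv (jac Φ) y w
      = LinearMap.toMatrix' (fderiv ℝ (fderiv ℝ Φ) y w).toLinearMap := by
    ext a μ
    have h2 : DifferentiableAt ℝ (fun z => fderiv ℝ Φ z (Pi.single μ 1)) y :=
      h.clm_apply (differentiableAt_const _)
    simp only [dirDeriv, jac, Matrix.of_apply, LinearMap.toMatrix'_apply]
    rw [fderiv_apply h2 a, fderiv_clm_apply h (differentiableAt_const _)]
    simp
  rw [h1, LinearMap.toMatrix'_mulVec]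
  rfl

/-- Symmetry of the second derivative. All cancellations of Hessian terms below, in the connection
and in the Lie derivative, come from it. -/
theorem dirDeriv_jac_symm {Φ : (Fin n → ℝ) → Fin n → ℝ} {y : Fin n → ℝ}
    (hΦ : ContDiffAt ℝ 2 Φ y) (w v : Fin n → ℝ) :
    dirDeriv (jac Φ) y w *ᵥ v = dirDeriv (jac Φ) y v *ᵥ w := by
  rw [dirDeriv_jac_mulVec hΦ, dirDeriv_jac_mulVec hΦ]
  exact (hΦ.isSymmSndFDerivAt (by simp)).eq w v

/-- The pull-back of a field of bilinear forms in coordinates. -/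
def pullMat (Φ : (Fin n → ℝ) → Fin n → ℝ) (h : (Fin n → ℝ) → Matrix (Fin n) (Fin n) ℝ)
    (y : Fin n → ℝ) : Matrix (Fin n) (Fin n) ℝ :=
  (jac Φ y)ᵀ * h (Φ y) * jac Φ y

/-- Product and chain rule; the first and last terms are the non-tensorial ones. Equality of `h'`
with the pull-back is asked only near `y`, because charts give it only locally. -/
theorem dirDeriv_pullMat {Φ : (Fin n → ℝ) → Fin n → ℝ} {y : Fin n → ℝ}
    {h h' : (Fin n → ℝ) → Matrix (Fin n) (Fin n) ℝ} (hΦ : ContDiffAt ℝ 2 Φ y)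
    (hh : EntryDiffAt h (Φ y)) (hh' : h' =ᶠ[𝓝 y] pullMat Φ h) (w : Fin n → ℝ) :
    dirDeriv h' y w = (dirDeriv (jac Φ) y w)ᵀ * h (Φ y) * jac Φ y
      + (jac Φ y)ᵀ * dirDeriv h (Φ y) (jac Φ y *ᵥ w) * jac Φ y
      + (jac Φ y)ᵀ * h (Φ y) * dirDeriv (jac Φ) y w := by
  have hd : DifferentiableAt ℝ Φ y := hΦ.differentiableAt (by norm_num)
  have hJ := entryDiffAt_jac hΦ
  rw [dirDeriv_congr hh']
  unfold pullMat
  rw [dirDeriv_mul (hJ.transpose.mul (hh.comp hd)) hJ, dirDeriv_mul hJ.transpose (hh.comp hd),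
    dirDeriv_transpose, dirDeriv_comp hh hd, add_mul]

/-- The Christoffel symbols of the first kind (times two), contracted with `w`. -/
def chrLower (g : (Fin n → ℝ) → Matrix (Fin n) (Fin n) ℝ) (y w : Fin n → ℝ) :
    Matrix (Fin n) (Fin n) ℝ :=
  Matrix.of fun κ ν => dirDeriv g y w κ ν + (dirDeriv g y (Pi.single ν 1) *ᵥ w) κ
    - (w ᵥ* dirDeriv g y (Pi.single κ 1)) ν

/-- The matrix `Γ^l_{γα} w^γ`. -/
def chrMat (g : (Fin n → ℝ) → Matrix (Fin n) (Fin n) ℝ) (y w : Fin n → ℝ) :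
    Matrix (Fin n) (Fin n) ℝ :=
  (1 / 2 : ℝ) • ((g y)⁻¹ * chrLower g y w)

/-- The covariant derivative in the direction `w`. -/
def covMat (g h : (Fin n → ℝ) → Matrix (Fin n) (Fin n) ℝ) (y w : Fin n → ℝ) :
    Matrix (Fin n) (Fin n) ℝ :=
  dirDeriv h y w - (chrMat g y w)ᵀ * h y - h y * chrMat g y w

theorem christoffel_eq (g : (Fin n → ℝ) → Matrix (Fin n) (Fin n) ℝ) (y : Fin n → ℝ)
    (l γ α : Fin n) : christoffel g l γ α y = chrMat g y (Pi.single γ 1) l α := by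
  simp [christoffel, chrMat, Matrix.mul_apply, chrLower, dirDeriv, pd]

theorem covDeriv_eq (g h : (Fin n → ℝ) → Matrix (Fin n) (Fin n) ℝ) (y : Fin n → ℝ)
    (γ α β : Fin n) : covDeriv g h γ α β y = covMat g h y (Pi.single γ 1) α β := by
  simp only [covDeriv, christoffel_eq, covMat, Matrix.sub_apply, Matrix.mul_apply,
    Matrix.transpose_apply, mul_comm (h y α _)]
  rfl

theorem dirDeriv_eq_sum (g : (Fin n → ℝ) → Matrix (Fin n) (Fin n) ℝ) (y v : Fin n → ℝ)
    (κ ν : Fin n) : dirDeriv g y v κ ν = ∑ j, v j * dirDeriv g y (Pi.single j 1) κ ν := by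
  simp only [dirDeriv, Matrix.of_apply]
  conv_lhs => rw [← Finset.univ_sum_single v, map_sum]
  refine Finset.sum_congr rfl fun j _ => ?_
  rw [← smul_eq_mul, ← map_smul, ← Pi.single_smul, smul_eq_mul, mul_one]

/-- Replaces the index formula by one for arbitrary vectors, in which the cancellations of
`chrLower_pullMat` are visible without sums. -/
theorem dotProduct_chrLower (g : (Fin n → ℝ) → Matrix (Fin n) (Fin n) ℝ) (y w x v : Fin n → ℝ) :
    x ⬝ᵥ chrLower g y w *ᵥ v = x ⬝ᵥ dirDeriv g y w *ᵥ v + x ⬝ᵥ dirDeriv g y v *ᵥ w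
      - w ⬝ᵥ dirDeriv g y x *ᵥ v := by
  have h1 : x ⬝ᵥ dirDeriv g y v *ᵥ w
      = x ⬝ᵥ (Matrix.of fun κ ν => (dirDeriv g y (Pi.single ν 1) *ᵥ w) κ) *ᵥ v := by
    congr 1
    ext κ
    simp only [Matrix.mulVec, dotProduct, Matrix.of_apply]
    simp_rw [dirDeriv_eq_sum g y v κ, Finset.sum_mul]
    rw [Finset.sum_comm]
    exact Finset.sum_congr rfl fun i _ => Finset.sum_congr rfl fun j _ => by ring
  have h2 : w ⬝ᵥ dirDeriv g y x *ᵥ v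
      = x ⬝ᵥ (Matrix.of fun κ ν => (w ᵥ* dirDeriv g y (Pi.single κ 1)) ν) *ᵥ v := by
    rw [Matrix.dotProduct_mulVec, Matrix.dotProduct_mulVec]
    congr 1
    ext ν
    simp only [Matrix.vecMul, dotProduct, Matrix.of_apply]
    simp_rw [dirDeriv_eq_sum g y x _ ν, Finset.mul_sum]
    rw [Finset.sum_comm]
    exact Finset.sum_congr rfl fun i _ => Finset.sum_congr rfl fun j _ => by ring
  rw [h1, h2, ← dotProduct_add, ← Matrix.add_mulVec, ← dotProduct_sub, ← Matrix.sub_mulVec]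
  rfl

theorem matrix_ext_dotProduct {A B : Matrix (Fin n) (Fin n) ℝ}
    (h : ∀ x v : Fin n → ℝ, x ⬝ᵥ A *ᵥ v = x ⬝ᵥ B *ᵥ v) : A = B := by
  ext i j
  simpa using h (Pi.single i 1) (Pi.single j 1)

theorem chrLower_add (g : (Fin n → ℝ) → Matrix (Fin n) (Fin n) ℝ) (y v w : Fin n → ℝ) :
    chrLower g y (v + w) = chrLower g y v + chrLower g y w := by
  ext i j
  simp only [chrLower, dirDeriv_add, Matrix.of_apply, Matrix.add_apply, Matrix.mulVec_add,
    Matrix.add_vecMul, Pi.add_apply]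
  ring

theorem chrLower_smul (g : (Fin n → ℝ) → Matrix (Fin n) (Fin n) ℝ) (y w : Fin n → ℝ) (c : ℝ) :
    chrLower g y (c • w) = c • chrLower g y w := by
  ext i j
  simp only [chrLower, dirDeriv_smul, Matrix.of_apply, Matrix.smul_apply, Matrix.mulVec_smul,
    Matrix.smul_vecMul, Pi.smul_apply, smul_eq_mul]
  ring

/-- The covariant derivative is linear in its direction. -/
def covLin (g h : (Fin n → ℝ) → Matrix (Fin n) (Fin n) ℝ) (y : Fin n → ℝ) :
    (Fin n → ℝ) →ₗ[ℝ] Matrix (Fin n) (Fin n) ℝ where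
  toFun := covMat g h y
  map_add' v w := by
    simp only [covMat, chrMat, dirDeriv_add, chrLower_add, mul_add, smul_add,
      Matrix.transpose_add, add_mul]
    abel
  map_smul' c w := by
    simp only [covMat, chrMat, dirDeriv_smul, chrLower_smul, Matrix.mul_smul, RingHom.id_apply,
      Matrix.transpose_smul, Matrix.smul_mul, smul_sub, smul_comm c (1 / 2 : ℝ)]

theorem covMat_apply_eq_sum (g h : (Fin n → ℝ) → Matrix (Fin n) (Fin n) ℝ)
    (y v : Fin n → ℝ) (α β : Fin n) :
    covMat g h y v α β = ∑ c, v c * covMat g h y (Pi.single c 1) α β := by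
  have h1 : covMat g h y v = ∑ c, v c • covMat g h y (Pi.single c 1) := by
    change covLin g h y v = ∑ c, v c • covLin g h y (Pi.single c 1)
    simp only [← map_smul]
    rw [← map_sum]
    congr 1
    conv_lhs => rw [← Finset.univ_sum_single v]
    refine Finset.sum_congr rfl fun j _ => ?_
    rw [← Pi.single_smul, smul_eq_mul, mul_one]
  rw [h1, Matrix.sum_apply]
  rfl

theorem dotProduct_transpose_mulVec (A : Matrix (Fin n) (Fin n) ℝ) (x v : Fin n → ℝ) :
    x ⬝ᵥ Aᵀ *ᵥ v = (A *ᵥ x) ⬝ᵥ v := by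
  rw [Matrix.dotProduct_mulVec, Matrix.vecMul_transpose]

theorem dotProduct_mulVec_symm {A : Matrix (Fin n) (Fin n) ℝ} (hA : Aᵀ = A) (x v : Fin n → ℝ) :
    x ⬝ᵥ A *ᵥ v = v ⬝ᵥ A *ᵥ x := by
  conv_lhs => rw [← hA, dotProduct_transpose_mulVec, dotProduct_comm]

/-- Each of the three derivatives of `g'` contributes two Hessian terms. By the symmetry of `g` and
of the Hessian four of the six cancel in pairs and the other two coincide, whence the factor 2. -/
theorem chrLower_pullMat {Φ : (Fin n → ℝ) → Fin n → ℝ} {y : Fin n → ℝ}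
    {g g' : (Fin n → ℝ) → Matrix (Fin n) (Fin n) ℝ} (hΦ : ContDiffAt ℝ 2 Φ y)
    (hg : EntryDiffAt g (Φ y)) (hs : (g (Φ y))ᵀ = g (Φ y)) (hg' : g' =ᶠ[𝓝 y] pullMat Φ g)
    (w : Fin n → ℝ) :
    chrLower g' y w = (jac Φ y)ᵀ * chrLower g (Φ y) (jac Φ y *ᵥ w) * jac Φ y
      + (2 : ℝ) • ((jac Φ y)ᵀ * g (Φ y) * dirDeriv (jac Φ) y w) := by
  apply matrix_ext_dotProduct
  intro x v
  rw [dotProduct_chrLower]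
  simp only [dirDeriv_pullMat hΦ hg hg', Matrix.add_mulVec, dotProduct_add,
    ← Matrix.mulVec_mulVec, dotProduct_transpose_mulVec, Matrix.smul_mulVec, dotProduct_smul,
    dotProduct_chrLower, smul_eq_mul]
  rw [dirDeriv_jac_symm hΦ x w, dirDeriv_jac_symm hΦ x v, dirDeriv_jac_symm hΦ v w,
    dotProduct_mulVec_symm hs (dirDeriv (jac Φ) y v *ᵥ x)]
  ring

/-- The inhomogeneous transformation law of a connection, multiplied by the Jacobian on the left so
that its inverse does not appear. -/
theorem chrMat_pullMat {Φ : (Fin n → ℝ) → Fin n → ℝ} {y : Fin n → ℝ}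
    {g g' : (Fin n → ℝ) → Matrix (Fin n) (Fin n) ℝ} (hΦ : ContDiffAt ℝ 2 Φ y)
    (hJ : IsUnit (jac Φ y).det)
    (hg : EntryDiffAt g (Φ y)) (hs : (g (Φ y))ᵀ = g (Φ y)) (hu : IsUnit (g (Φ y)).det)
    (hg' : g' =ᶠ[𝓝 y] pullMat Φ g) (w : Fin n → ℝ) :
    jac Φ y * chrMat g' y w
      = chrMat g (Φ y) (jac Φ y *ᵥ w) * jac Φ y + dirDeriv (jac Φ) y w := by
  have hJt : IsUnit ((jac Φ y)ᵀ).det := by rwa [Matrix.det_transpose]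
  rw [chrMat, chrMat, chrLower_pullMat hΦ hg hs hg', hg'.self_of_nhds, pullMat,
    Matrix.mul_inv_rev, Matrix.mul_inv_rev, Matrix.mul_smul, ← mul_assoc, ← mul_assoc,
    Matrix.mul_nonsing_inv _ hJ, one_mul, mul_add, Matrix.mul_smul, smul_add, smul_smul]
  congr 1
  · rw [Matrix.smul_mul]
    congr 1
    simp only [mul_assoc]
    rw [← mul_assoc ((jac Φ y)ᵀ⁻¹), Matrix.nonsing_inv_mul _ hJt, one_mul]
  · norm_num
    simp only [mul_assoc]
    rw [← mul_assoc ((jac Φ y)ᵀ⁻¹), Matrix.nonsing_inv_mul _ hJt, one_mul, ← mul_assoc,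
      Matrix.nonsing_inv_mul _ hu, one_mul]

/-- The inhomogeneous part of `chrMat_pullMat` cancels the two Hessian terms of `dirDeriv_pullMat`;
this is what makes the covariant derivative a tensor. -/
theorem covMat_pullMat {Φ : (Fin n → ℝ) → Fin n → ℝ} {y : Fin n → ℝ}
    {g g' h h' : (Fin n → ℝ) → Matrix (Fin n) (Fin n) ℝ} (hΦ : ContDiffAt ℝ 2 Φ y)
    (hJ : IsUnit (jac Φ y).det)
    (hg : EntryDiffAt g (Φ y)) (hs : (g (Φ y))ᵀ = g (Φ y)) (hu : IsUnit (g (Φ y)).det)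
    (hg' : g' =ᶠ[𝓝 y] pullMat Φ g) (hh : EntryDiffAt h (Φ y))
    (hh' : h' =ᶠ[𝓝 y] pullMat Φ h) (w : Fin n → ℝ) :
    covMat g' h' y w = (jac Φ y)ᵀ * covMat g h (Φ y) (jac Φ y *ᵥ w) * jac Φ y := by
  have key := chrMat_pullMat hΦ hJ hg hs hu hg' w
  have e1 : (chrMat g' y w)ᵀ * h' y
      = (jac Φ y * chrMat g' y w)ᵀ * h (Φ y) * jac Φ y := by
    rw [hh'.self_of_nhds, pullMat, Matrix.transpose_mul]
    simp only [mul_assoc]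
  have e2 : h' y * chrMat g' y w = (jac Φ y)ᵀ * h (Φ y) * (jac Φ y * chrMat g' y w) := by
    rw [hh'.self_of_nhds, pullMat]
    simp only [mul_assoc]
  rw [covMat, e1, e2, key, dirDeriv_pullMat hΦ hh hh', covMat, Matrix.transpose_add,
    Matrix.transpose_mul]
  noncomm_ring

/-- The Lie derivative in matrix form. -/
theorem lieMetric_eq {ξ : (Fin n → ℝ) → Fin n → ℝ} {y : Fin n → ℝ}
    (hξ : DifferentiableAt ℝ ξ y) (g : (Fin n → ℝ) → Matrix (Fin n) (Fin n) ℝ) :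
    lieMetric ξ g y = dirDeriv g y (ξ y) + (jac ξ y)ᵀ * g y + g y * jac ξ y := by
  ext μ ν
  simp only [lieMetric, Matrix.of_apply, Matrix.add_apply, Finset.sum_add_distrib,
    Matrix.mul_apply, Matrix.transpose_apply, jac_apply_eq hξ, mul_comm (pd _ _ _) (g y _ _)]
  rw [dirDeriv_eq_sum]
  rfl

/-- The relation `ξ ∘ Φ = (jac Φ) ξ'` is differentiated; symmetry of the Hessian turns the
derivative of the Jacobian into one in the direction `ξ'`. -/
theorem jac_comp_eq {Φ ξ ξ' : (Fin n → ℝ) → Fin n → ℝ} {y : Fin n → ℝ}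
    (hΦ : ContDiffAt ℝ 2 Φ y) (hξ : DifferentiableAt ℝ ξ (Φ y)) (hξ' : DifferentiableAt ℝ ξ' y)
    (h : ∀ᶠ z in 𝓝 y, ξ (Φ z) = jac Φ z *ᵥ ξ' z) :
    jac ξ (Φ y) * jac Φ y = dirDeriv (jac Φ) y (ξ' y) + jac Φ y * jac ξ' y := by
  have hd : DifferentiableAt ℝ Φ y := hΦ.differentiableAt (by norm_num)
  have h2 : DifferentiableAt ℝ (fderiv ℝ Φ) y :=
    (hΦ.fderiv_right (m := 1) (by norm_num)).differentiableAt (by norm_num)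
  apply Matrix.ext_of_mulVec_single
  intro μ
  rw [Matrix.add_mulVec, ← Matrix.mulVec_mulVec, ← Matrix.mulVec_mulVec,
    dirDeriv_jac_symm hΦ, dirDeriv_jac_mulVec hΦ]
  simp only [jac_mulVec] at h ⊢
  have e : (fun z => ξ (Φ z)) =ᶠ[𝓝 y] fun z => fderiv ℝ Φ z (ξ' z) := h
  have e2 := e.fderiv_eq (𝕜 := ℝ)
  have e5 := fderiv_clm_apply h2 hξ'
  rw [e5] at e2
  have e3 : fderiv ℝ (ξ ∘ Φ) y = (fderiv ℝ ξ (Φ y)).comp (fderiv ℝ Φ y) := fderiv_comp y hξ hd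
  simp only [Function.comp_def] at e3
  rw [e3] at e2
  have e4 := congrArg (fun L : (Fin n → ℝ) →L[ℝ] Fin n → ℝ => L (Pi.single μ (1 : ℝ))) e2
  simp only [ContinuousLinearMap.comp_apply, add_apply,
    ContinuousLinearMap.flip_apply] at e4
  rw [e4, add_comm]

/-- Naturality of the Lie derivative: by `jac_comp_eq` the Hessian terms from the transport of `g'`
along `ξ'` cancel the derivatives of `ξ'`, leaving those of `ξ`. -/
theorem lieMetric_pullMat {Φ ξ ξ' : (Fin n → ℝ) → Fin n → ℝ} {y : Fin n → ℝ}
    {g g' : (Fin n → ℝ) → Matrix (Fin n) (Fin n) ℝ} (hΦ : ContDiffAt ℝ 2 Φ y)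
    (hξ : DifferentiableAt ℝ ξ (Φ y)) (hξ' : DifferentiableAt ℝ ξ' y)
    (h : ∀ᶠ z in 𝓝 y, ξ (Φ z) = jac Φ z *ᵥ ξ' z)
    (hg : EntryDiffAt g (Φ y)) (hg' : g' =ᶠ[𝓝 y] pullMat Φ g) :
    lieMetric ξ' g' y = pullMat Φ (lieMetric ξ g) y := by
  have key := jac_comp_eq hΦ hξ hξ' h
  have key' : dirDeriv (jac Φ) y (ξ' y) = jac ξ (Φ y) * jac Φ y - jac Φ y * jac ξ' y := by
    rw [key]; abel
  rw [lieMetric_eq hξ', pullMat, lieMetric_eq hξ, dirDeriv_pullMat hΦ hg hg', key',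
    hg'.self_of_nhds, pullMat, h.self_of_nhds, Matrix.transpose_sub, Matrix.transpose_mul,
    Matrix.transpose_mul]
  noncomm_ring

end Covariance

/-! ### The pre-symplectic current as a vector density -/

section Current

variable {n : ℕ}

/-- The tensor that contracts `δ_{[1} g_{ρσ} ∇_γ δ_{2]} g_{αβ}` in the pre-symplectic current. -/
def currentTensor (i : Matrix (Fin n) (Fin n) ℝ) (ν α β γ ρ σ : Fin n) : ℝ :=
  i ν α * (i ρ σ * i β γ - 2 * i ρ β * i σ γ)
    + i ν γ * (i ρ α * i σ β - i ρ σ * i α β) + i ν ρ * i α β * i σ γ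

/-- Every monomial of `currentTensor` ties `ν` to one summed index and splits the other four into
two pairs, so its contraction factors in this way once the indices are reordered. -/
theorem sum_five_factor (F₁ : Fin n → ℝ) (F₂ F₃ : Fin n → Fin n → ℝ) :
    ∑ a, ∑ b, ∑ c, ∑ d, ∑ e, F₁ a * (F₂ b c * F₃ d e)
      = (∑ a, F₁ a) * ((∑ b, ∑ c, F₂ b c) * ∑ d, ∑ e, F₃ d e) := by
  simp only [Finset.sum_mul, ← Finset.mul_sum]

theorem sum_rotate_three (f : Fin n → Fin n → Fin n → ℝ) :
    ∑ a, ∑ b, ∑ c, f a b c = ∑ c, ∑ a, ∑ b, f a b c := by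
  rw [Finset.sum_comm (s := Finset.univ) (t := Finset.univ) (f := fun c a => ∑ b, f a b c)]
  exact Finset.sum_congr rfl fun a _ => Finset.sum_comm

/-- The contraction of all lower indices of `currentTensor i'` with a matrix `J` for which
`i' Jᵀ = L i` and `J i' Jᵀ = i`. -/
theorem currentTensor_contract {i i' J L : Matrix (Fin n) (Fin n) ℝ} (h₁ : i' * Jᵀ = L * i)
    (h₂ : J * i' * Jᵀ = i) (ν A B C R S : Fin n) :
    ∑ α, ∑ β, ∑ γ, ∑ ρ, ∑ σ, currentTensor i' ν α β γ ρ σ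
        * (J A α * J B β * J C γ * J R ρ * J S σ)
      = ∑ N, L ν N * currentTensor i N A B C R S := by
  have e₁ : ∀ A, ∑ α, i' ν α * J A α = ∑ N, L ν N * i N A := fun A => by
    simpa [Matrix.mul_apply] using congrFun (congrFun h₁ ν) A
  have e₂ : ∀ A B, ∑ α, ∑ β, i' α β * J A α * J B β = i A B := fun A B => by
    rw [← congrFun (congrFun h₂ A) B]
    simp only [Matrix.mul_apply, Matrix.transpose_apply, Finset.sum_mul]
    rw [Finset.sum_comm]
    exact Finset.sum_congr rfl fun α _ => Finset.sum_congr rfl fun β _ => by ring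
  have e₂' : ∀ A B, ∑ α, ∑ β, i' β α * J A α * J B β = i B A := fun A B => by
    rw [← e₂ B A, Finset.sum_comm]
    exact Finset.sum_congr rfl fun α _ => Finset.sum_congr rfl fun β _ => by ring
  -- One identity for each of the five monomials of `currentTensor`: the factor with the free index
  -- `ν` produces `L`, the two others are invariant by `h₂`.
  have t₁ : ∑ α, ∑ β, ∑ γ, ∑ ρ, ∑ σ, (i' ν α * J A α)
      * ((i' β γ * J B β * J C γ) * (i' ρ σ * J R ρ * J S σ))
      = (∑ N, L ν N * i N A) * (i B C * i R S) := by
    rw [sum_five_factor, e₁, e₂, e₂]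
  have t₂ : ∑ α, ∑ β, ∑ γ, ∑ ρ, ∑ σ, (i' ν α * J A α)
      * ((i' ρ β * J B β * J R ρ) * (i' σ γ * J C γ * J S σ))
      = (∑ N, L ν N * i N A) * (i R B * i S C) := by
    rw [← e₁, ← e₂' B R, ← e₂' C S, ← sum_five_factor]
    exact Finset.sum_congr rfl fun α _ => Finset.sum_congr rfl fun β _ => Finset.sum_comm
  have t₃ : ∑ α, ∑ β, ∑ γ, ∑ ρ, ∑ σ, (i' ν γ * J C γ)
      * ((i' ρ α * J A α * J R ρ) * (i' σ β * J B β * J S σ))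
      = (∑ N, L ν N * i N C) * (i R A * i S B) := by
    rw [← e₁, ← e₂' A R, ← e₂' B S, ← sum_five_factor, sum_rotate_three]
    exact Finset.sum_congr rfl fun α _ => Finset.sum_congr rfl fun β _ => Finset.sum_comm
  have t₄ : ∑ α, ∑ β, ∑ γ, ∑ ρ, ∑ σ, (i' ν γ * J C γ)
      * ((i' α β * J A α * J B β) * (i' ρ σ * J R ρ * J S σ))
      = (∑ N, L ν N * i N C) * (i A B * i R S) := by
    rw [← e₁, ← e₂ A B, ← e₂ R S, ← sum_five_factor, sum_rotate_three]
  have t₅ : ∑ α, ∑ β, ∑ γ, ∑ ρ, ∑ σ, (i' ν ρ * J R ρ)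
      * ((i' α β * J A α * J B β) * (i' σ γ * J C γ * J S σ))
      = (∑ N, L ν N * i N R) * (i A B * i S C) := by
    rw [← e₁, ← e₂ A B, ← e₂' C S, ← sum_five_factor, ← sum_rotate_three
      fun α β ρ => ∑ γ, ∑ σ, (i' ν ρ * J R ρ)
        * ((i' α β * J A α * J B β) * (i' σ γ * J C γ * J S σ))]
    exact Finset.sum_congr rfl fun α _ => Finset.sum_congr rfl fun β _ => Finset.sum_comm
  have lhs : ∑ α, ∑ β, ∑ γ, ∑ ρ, ∑ σ, currentTensor i' ν α β γ ρ σ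
        * (J A α * J B β * J C γ * J R ρ * J S σ)
      = (∑ N, L ν N * i N A) * (i B C * i R S) - 2 * ((∑ N, L ν N * i N A) * (i R B * i S C))
        + (∑ N, L ν N * i N C) * (i R A * i S B) - (∑ N, L ν N * i N C) * (i A B * i R S)
        + (∑ N, L ν N * i N R) * (i A B * i S C) := by
    rw [← t₁, ← t₂, ← t₃, ← t₄, ← t₅]
    simp only [Finset.mul_sum, ← Finset.sum_add_distrib, ← Finset.sum_sub_distrib]
    refine Finset.sum_congr rfl fun α _ => Finset.sum_congr rfl fun β _ =>
      Finset.sum_congr rfl fun γ _ => Finset.sum_congr rfl fun ρ _ =>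
      Finset.sum_congr rfl fun σ _ => ?_
    rw [currentTensor]
    ring
  rw [lhs]
  simp only [Finset.sum_mul, Finset.mul_sum, ← Finset.sum_add_distrib, ← Finset.sum_sub_distrib]
  refine Finset.sum_congr rfl fun N _ => ?_
  rw [currentTensor]
  ring

/-- Interchange of two five-fold sums. -/
theorem sum_five_comm (f : Fin n → Fin n → Fin n → Fin n → Fin n →
      Fin n → Fin n → Fin n → Fin n → Fin n → ℝ) :
    ∑ α, ∑ β, ∑ γ, ∑ ρ, ∑ σ, ∑ A, ∑ B, ∑ C, ∑ R, ∑ S, f α β γ ρ σ A B C R S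
      = ∑ A, ∑ B, ∑ C, ∑ R, ∑ S, ∑ α, ∑ β, ∑ γ, ∑ ρ, ∑ σ, f α β γ ρ σ A B C R S := by
  have := Finset.sum_comm (s := (Finset.univ : Finset (Fin n × Fin n × Fin n × Fin n × Fin n)))
    (t := (Finset.univ : Finset (Fin n × Fin n × Fin n × Fin n × Fin n)))
    (f := fun p q => f p.1 p.2.1 p.2.2.1 p.2.2.2.1 p.2.2.2.2 q.1 q.2.1 q.2.2.1 q.2.2.2.1 q.2.2.2.2)
  simpa only [Fintype.sum_prod_type] using this

theorem pullMat_apply (J h : Matrix (Fin n) (Fin n) ℝ) (ρ σ : Fin n) :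
    (Jᵀ * h * J) ρ σ = ∑ R, ∑ S, J R ρ * J S σ * h R S := by
  simp only [Matrix.mul_apply, Matrix.transpose_apply, Finset.sum_mul]
  rw [Finset.sum_comm]
  exact Finset.sum_congr rfl fun α _ => Finset.sum_congr rfl fun β _ => by ring

/-- The current is a contraction of `currentTensor`. -/
theorem symplecticCurrent_eq (G : ℝ) (g h₁ h₂ : (Fin n → ℝ) → Matrix (Fin n) (Fin n) ℝ)
    (y : Fin n → ℝ) (ν : Fin n) :
    symplecticCurrent G g h₁ h₂ y ν = Real.sqrt (-(g y).det) / (16 * Real.pi * G) *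
      ∑ α, ∑ β, ∑ γ, ∑ ρ, ∑ σ, currentTensor (g y)⁻¹ ν α β γ ρ σ
      * ((1 / 2) * (h₁ y ρ σ * covDeriv g h₂ γ α β y - h₂ y ρ σ * covDeriv g h₁ γ α β y)) := rfl

theorem covDeriv_pullMat {Φ : (Fin n → ℝ) → Fin n → ℝ} {y : Fin n → ℝ}
    {g g' h h' : (Fin n → ℝ) → Matrix (Fin n) (Fin n) ℝ} (hΦ : ContDiffAt ℝ 2 Φ y)
    (hJ : IsUnit (jac Φ y).det)
    (hg : EntryDiffAt g (Φ y)) (hs : (g (Φ y))ᵀ = g (Φ y)) (hu : IsUnit (g (Φ y)).det)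
    (hg' : g' =ᶠ[𝓝 y] pullMat Φ g) (hh : EntryDiffAt h (Φ y))
    (hh' : h' =ᶠ[𝓝 y] pullMat Φ h) (γ α β : Fin n) :
    covDeriv g' h' γ α β y = ∑ A, ∑ B, ∑ C,
      jac Φ y A α * jac Φ y B β * jac Φ y C γ * covDeriv g h C A B (Φ y) := by
  rw [covDeriv_eq, covMat_pullMat hΦ hJ hg hs hu hg' hh hh', pullMat_apply]
  refine Finset.sum_congr rfl fun A _ => Finset.sum_congr rfl fun B _ => ?_
  rw [covMat_apply_eq_sum, Finset.mul_sum]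
  refine Finset.sum_congr rfl fun C _ => ?_
  rw [covDeriv_eq]
  simp
  ring

/-- The pre-symplectic current transforms as a vector density. -/
theorem jac_mulVec_symplecticCurrent {Φ : (Fin n → ℝ) → Fin n → ℝ} {y : Fin n → ℝ}
    {g g' h₁ h₁' h₂ h₂' : (Fin n → ℝ) → Matrix (Fin n) (Fin n) ℝ} (G : ℝ)
    (hΦ : ContDiffAt ℝ 2 Φ y) (hJ : IsUnit (jac Φ y).det)
    (hg : EntryDiffAt g (Φ y)) (hs : (g (Φ y))ᵀ = g (Φ y)) (hu : IsUnit (g (Φ y)).det)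
    (hg' : g' =ᶠ[𝓝 y] pullMat Φ g)
    (hh₁ : EntryDiffAt h₁ (Φ y)) (hh₁' : h₁' =ᶠ[𝓝 y] pullMat Φ h₁)
    (hh₂ : EntryDiffAt h₂ (Φ y)) (hh₂' : h₂' =ᶠ[𝓝 y] pullMat Φ h₂) :
    symplecticCurrent G g' h₁' h₂' y = |(jac Φ y).det| •
      ((jac Φ y)⁻¹ *ᵥ symplecticCurrent G g h₁ h₂ (Φ y)) := by
  set J := jac Φ y with hJdef
  have hJt : IsUnit (Jᵀ).det := by rwa [Matrix.det_transpose]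
  have hinv : (g' y)⁻¹ = J⁻¹ * (g (Φ y))⁻¹ * (Jᵀ)⁻¹ := by
    rw [hg'.self_of_nhds, pullMat, Matrix.mul_inv_rev, Matrix.mul_inv_rev, mul_assoc]
  have k₁ : (g' y)⁻¹ * Jᵀ = J⁻¹ * (g (Φ y))⁻¹ := by
    rw [hinv, mul_assoc, Matrix.nonsing_inv_mul _ hJt, mul_one]
  have k₂ : J * (g' y)⁻¹ * Jᵀ = (g (Φ y))⁻¹ := by
    rw [mul_assoc, k₁, ← mul_assoc, Matrix.mul_nonsing_inv _ hJ, one_mul]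
  -- The square root of `det² ` is an absolute value: hence the weight `|det|`, insensitive to
  -- orientation.
  have hdet : Real.sqrt (-(g' y).det) = |J.det| * Real.sqrt (-(g (Φ y)).det) := by
    have : -(g' y).det = J.det ^ 2 * (-(g (Φ y)).det) := by
      rw [hg'.self_of_nhds, pullMat, Matrix.det_mul, Matrix.det_mul, Matrix.det_transpose]
      ring
    rw [this, Real.sqrt_mul (sq_nonneg _), Real.sqrt_sq_eq_abs]
  have hX : ∀ α β γ ρ σ,
      (1 / 2) * (h₁' y ρ σ * covDeriv g' h₂' γ α β y - h₂' y ρ σ * covDeriv g' h₁' γ α β y)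
        = ∑ A, ∑ B, ∑ C, ∑ R, ∑ S, (J A α * J B β * J C γ * J R ρ * J S σ)
          * ((1 / 2) * (h₁ (Φ y) R S * covDeriv g h₂ C A B (Φ y)
            - h₂ (Φ y) R S * covDeriv g h₁ C A B (Φ y))) := by
    intro α β γ ρ σ
    rw [mul_comm (h₁' y ρ σ), mul_comm (h₂' y ρ σ),
      covDeriv_pullMat hΦ hJ hg hs hu hg' hh₁ hh₁', covDeriv_pullMat hΦ hJ hg hs hu hg' hh₂ hh₂',
      hh₁'.self_of_nhds, hh₂'.self_of_nhds, pullMat, pullMat, pullMat_apply, pullMat_apply]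
    simp only [Finset.sum_mul]
    simp only [Finset.mul_sum, ← Finset.sum_sub_distrib]
    refine Finset.sum_congr rfl fun A _ => Finset.sum_congr rfl fun B _ =>
      Finset.sum_congr rfl fun C _ => Finset.sum_congr rfl fun R _ =>
      Finset.sum_congr rfl fun S _ => ?_
    ring
  funext ν
  rw [Pi.smul_apply, smul_eq_mul]
  simp only [Matrix.mulVec, dotProduct]
  simp only [symplecticCurrent_eq, hX, hdet]
  have c : ∀ F : Fin n → Fin n → Fin n → Fin n → Fin n → ℝ,
      ∑ α, ∑ β, ∑ γ, ∑ ρ, ∑ σ, currentTensor (g' y)⁻¹ ν α β γ ρ σ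
        * ∑ A, ∑ B, ∑ C, ∑ R, ∑ S, (J A α * J B β * J C γ * J R ρ * J S σ) * F A B C R S
      = ∑ A, ∑ B, ∑ C, ∑ R, ∑ S, (∑ N, J⁻¹ ν N * currentTensor (g (Φ y))⁻¹ N A B C R S)
        * F A B C R S := by
    intro F
    simp only [Finset.mul_sum, ← mul_assoc]
    rw [sum_five_comm]
    simp only [← currentTensor_contract k₁ k₂, mul_assoc, Finset.sum_mul]
  rw [c]
  -- Moves the sum over `N` outside, where it is the product of `J⁻¹` with the current at `Φ y`.
  have e : ∀ F : Fin n → Fin n → Fin n → Fin n → Fin n → ℝ,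
      ∑ A, ∑ B, ∑ C, ∑ R, ∑ S, (∑ N, J⁻¹ ν N * currentTensor (g (Φ y))⁻¹ N A B C R S)
        * F A B C R S
      = ∑ N, J⁻¹ ν N * ∑ A, ∑ B, ∑ C, ∑ R, ∑ S, currentTensor (g (Φ y))⁻¹ N A B C R S
        * F A B C R S := by
    intro F
    have := Finset.sum_comm (s := (Finset.univ : Finset (Fin n × Fin n × Fin n × Fin n × Fin n)))
      (t := (Finset.univ : Finset (Fin n)))
      (f := fun p N => J⁻¹ ν N * (currentTensor (g (Φ y))⁻¹ N p.1 p.2.1 p.2.2.1 p.2.2.2.1 p.2.2.2.2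
        * F p.1 p.2.1 p.2.2.1 p.2.2.2.1 p.2.2.2.2))
    simp only [Fintype.sum_prod_type] at this
    simpa only [Finset.mul_sum, Finset.sum_mul, mul_assoc] using this
  rw [e]
  simp only [Finset.mul_sum (s := Finset.univ) (a := |J.det|)]
  rw [Finset.mul_sum]
  exact Finset.sum_congr rfl fun N _ => by ring

end Current

/-! ### Coordinate systems of the spacetime -/

section Charts

variable {m : ℕ} {K : Type*} [TopologicalSpace K]

theorem angular_coordMap (e : OpenPartialHomeomorph K (EuclideanSpace ℝ (Fin m))) (p : Spc K) :
    angular (coordMap e p) = e p.2.2 := by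
  ext i; simp [angular, coordMap]

theorem coordInv_coordMap {e : OpenPartialHomeomorph K (EuclideanSpace ℝ (Fin m))} {p : Spc K}
    (hp : p.2.2 ∈ e.source) : coordInv e (coordMap e p) = p := by
  rw [coordInv, angular_coordMap, e.left_inv hp]
  rfl

theorem coordMap_coordInv {e : OpenPartialHomeomorph K (EuclideanSpace ℝ (Fin m))}
    {y : Fin (m + 2) → ℝ} (hy : angular y ∈ e.target) : coordMap e (coordInv e y) = y := by
  funext μ
  refine Fin.cases rfl (fun μ => ?_) μ
  refine Fin.cases rfl (fun i => ?_) μ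
  change e (e.symm (angular y)) i = y i.succ.succ
  rw [e.right_inv hy]
  rfl

theorem coordInv_mem_source {e : OpenPartialHomeomorph K (EuclideanSpace ℝ (Fin m))}
    {y : Fin (m + 2) → ℝ} (hy : angular y ∈ e.target) : (coordInv e y).2.2 ∈ e.source :=
  e.map_target hy

theorem contDiff_angular : ContDiff ℝ ∞ (angular (m := m)) :=
  (contDiff_piLp 2).2 fun i => contDiff_apply ℝ ℝ i.succ.succ

theorem isOpen_angular_preimage (e : OpenPartialHomeomorph K (EuclideanSpace ℝ (Fin m))) :
    IsOpen {y : Fin (m + 2) → ℝ | angular y ∈ e.target} :=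
  e.open_target.preimage contDiff_angular.continuous

theorem isOpen_source_preimage (e : OpenPartialHomeomorph K (EuclideanSpace ℝ (Fin m))) :
    IsOpen {p : Spc K | p.2.2 ∈ e.source} :=
  e.open_source.preimage (by fun_prop)

variable [ChartedSpace (EuclideanSpace ℝ (Fin m)) K] [IsManifold (𝓡 m) ∞ K]

theorem contMDiffAt_coordMap {e : OpenPartialHomeomorph K (EuclideanSpace ℝ (Fin m))}
    (he : e ∈ atlas (EuclideanSpace ℝ (Fin m)) K) {p : Spc K} (hp : p.2.2 ∈ e.source) :
    ContMDiffAt (Mdl m) 𝓘(ℝ, Fin (m + 2) → ℝ) ∞ (coordMap e) p := by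
  have h1 : ContMDiffAt (𝓡 m) (𝓡 m) ∞ e p.2.2 :=
    (contMDiffOn_of_mem_maximalAtlas (IsManifold.subset_maximalAtlas he)).contMDiffAt
      (e.open_source.mem_nhds hp)
  have h2 : ContMDiffAt (Mdl m) (𝓡 m) ∞ (fun q : Spc K => e q.2.2) p :=
    ContMDiffAt.comp p h1 ((contMDiffAt_snd).snd)
  rw [contMDiffAt_pi_space]
  intro μ
  refine Fin.cases ?_ (fun μ => ?_) μ
  · exact contMDiffAt_fst
  refine Fin.cases ?_ (fun i => ?_) μ
  · exact contMDiffAt_snd.fst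
  · change ContMDiffAt (Mdl m) 𝓘(ℝ, ℝ) ∞ (fun q : Spc K => e q.2.2 i) p
    have h3 : ContMDiffAt (𝓡 m) 𝓘(ℝ, ℝ) ∞
        (fun v : EuclideanSpace ℝ (Fin m) => v i) (e p.2.2) :=
      ((contDiff_euclidean.1 contDiff_id) i).contMDiff.contMDiffAt
    exact ContMDiffAt.comp p h3 h2

theorem contMDiffAt_coordInv {e : OpenPartialHomeomorph K (EuclideanSpace ℝ (Fin m))}
    (he : e ∈ atlas (EuclideanSpace ℝ (Fin m)) K) {y : Fin (m + 2) → ℝ}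
    (hy : angular y ∈ e.target) :
    ContMDiffAt 𝓘(ℝ, Fin (m + 2) → ℝ) (Mdl m) ∞ (coordInv e) y := by
  have h1 : ContMDiffAt (𝓡 m) (𝓡 m) ∞ e.symm (angular y) :=
    (contMDiffOn_symm_of_mem_maximalAtlas (IsManifold.subset_maximalAtlas he)).contMDiffAt
      (e.open_target.mem_nhds hy)
  have h2 : ContMDiffAt 𝓘(ℝ, Fin (m + 2) → ℝ) (𝓡 m) ∞ (fun z => e.symm (angular z)) y :=
    ContMDiffAt.comp y h1 contDiff_angular.contMDiff.contMDiffAt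
  have hc : ∀ μ, ContMDiffAt 𝓘(ℝ, Fin (m + 2) → ℝ) 𝓘(ℝ, ℝ) ∞ (fun z : Fin (m + 2) → ℝ => z μ) y :=
    fun μ => (contDiff_apply ℝ ℝ μ).contMDiff.contMDiffAt
  exact (hc 0).prodMk ((hc 1).prodMk h2)

theorem mdifferentiableAt_coordMap {e : OpenPartialHomeomorph K (EuclideanSpace ℝ (Fin m))}
    (he : e ∈ atlas (EuclideanSpace ℝ (Fin m)) K) {p : Spc K} (hp : p.2.2 ∈ e.source) :
    MDifferentiableAt (Mdl m) 𝓘(ℝ, Fin (m + 2) → ℝ) (coordMap e) p :=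
  (contMDiffAt_coordMap he hp).mdifferentiableAt (by simp)

theorem mdifferentiableAt_coordInv {e : OpenPartialHomeomorph K (EuclideanSpace ℝ (Fin m))}
    (he : e ∈ atlas (EuclideanSpace ℝ (Fin m)) K) {y : Fin (m + 2) → ℝ}
    (hy : angular y ∈ e.target) :
    MDifferentiableAt 𝓘(ℝ, Fin (m + 2) → ℝ) (Mdl m) (coordInv e) y :=
  (contMDiffAt_coordInv he hy).mdifferentiableAt (by simp)

/-- The differential of the coordinate map inverts that of its inverse. -/
theorem mfderiv_coordInv_mfderiv_coordMap
    {e : OpenPartialHomeomorph K (EuclideanSpace ℝ (Fin m))}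
    (he : e ∈ atlas (EuclideanSpace ℝ (Fin m)) K) {p : Spc K} (hp : p.2.2 ∈ e.source)
    (v : TangentSpace (Mdl m) p) :
    (mfderiv 𝓘(ℝ, Fin (m + 2) → ℝ) (Mdl m) (coordInv e) (coordMap e p)
      (mfderiv (Mdl m) 𝓘(ℝ, Fin (m + 2) → ℝ) (coordMap e) p v) :
        ℝ × ℝ × EuclideanSpace ℝ (Fin m)) = v := by
  have hy : angular (coordMap e p) ∈ e.target := by
    rw [angular_coordMap]; exact e.map_source hp
  have h := mfderiv_comp p (mdifferentiableAt_coordInv he hy) (mdifferentiableAt_coordMap he hp)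
  have h2 : (coordInv e ∘ coordMap e) =ᶠ[𝓝 p] id :=
    ((isOpen_source_preimage e).eventually_mem hp).mono fun q hq => coordInv_coordMap hq
  have h3 : (mfderiv (Mdl m) (Mdl m) (coordInv e ∘ coordMap e) p v :
      ℝ × ℝ × EuclideanSpace ℝ (Fin m)) = v := by
    rw [h2.mfderiv_eq, mfderiv_id]; rfl
  rw [h] at h3
  exact h3

theorem mfderiv_coordMap_mfderiv_coordInv
    {e : OpenPartialHomeomorph K (EuclideanSpace ℝ (Fin m))}
    (he : e ∈ atlas (EuclideanSpace ℝ (Fin m)) K) {y : Fin (m + 2) → ℝ}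
    (hy : angular y ∈ e.target) (v : Fin (m + 2) → ℝ) :
    (mfderiv (Mdl m) 𝓘(ℝ, Fin (m + 2) → ℝ) (coordMap e) (coordInv e y)
      (mfderiv 𝓘(ℝ, Fin (m + 2) → ℝ) (Mdl m) (coordInv e) y v) : Fin (m + 2) → ℝ) = v := by
  have h := mfderiv_comp y (mdifferentiableAt_coordMap he (coordInv_mem_source hy))
    (mdifferentiableAt_coordInv he hy)
  have h2 : (coordMap e ∘ coordInv e) =ᶠ[𝓝 y] id :=
    ((isOpen_angular_preimage e).eventually_mem hy).mono fun q hq => coordMap_coordInv hq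
  have h3 : (mfderiv 𝓘(ℝ, Fin (m + 2) → ℝ) 𝓘(ℝ, Fin (m + 2) → ℝ) (coordMap e ∘ coordInv e) y v :
      Fin (m + 2) → ℝ) = v := by
    rw [h2.mfderiv_eq, mfderiv_id]; rfl
  rw [h] at h3
  exact h3

end Charts

/-! ### Diffeomorphisms, metrics and vector fields in coordinates -/

section Transition

variable {m : ℕ} {K : Type*} [TopologicalSpace K]

/-- The coordinate expression of a map of the spacetime. -/
def coordExpr (e e' : OpenPartialHomeomorph K (EuclideanSpace ℝ (Fin m))) (φ : Spc K → Spc K)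
    (y : Fin (m + 2) → ℝ) : Fin (m + 2) → ℝ :=
  coordMap e' (φ (coordInv e y))

/-- The coordinates `y` in the chart `e` describe a point of `W` whose image under `φ` is covered
by the chart `e'`. -/
structure InCharts (W : Set (Spc K)) (e e' : OpenPartialHomeomorph K (EuclideanSpace ℝ (Fin m)))
    (φ : Spc K → Spc K) (y : Fin (m + 2) → ℝ) : Prop where
  ang : angular y ∈ e.target
  mem : coordInv e y ∈ W
  image : (φ (coordInv e y)).2.2 ∈ e'.source

variable {M W : Set (Spc K)} {φ : Spc K → Spc K}
  {e e' : OpenPartialHomeomorph K (EuclideanSpace ℝ (Fin m))} {y : Fin (m + 2) → ℝ}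

theorem coordInv_coordExpr (h : InCharts W e e' φ y) :
    coordInv e' (coordExpr e e' φ y) = φ (coordInv e y) :=
  coordInv_coordMap h.image

theorem isOpen_inside (hM : IsOpen M) : IsOpen (inside M) :=
  hM.inter (isOpen_lt continuous_const (continuous_fst.comp continuous_snd))

variable [ChartedSpace (EuclideanSpace ℝ (Fin m)) K]

/-- A diffeomorphism of `M` that preserves the regions `ρ = 0` and `ρ > 0`. -/
structure IsAdaptedDiffeo (M : Set (Spc K)) (φ : Spc K → Spc K) : Prop where
  mapsTo : MapsTo φ M M
  smooth : ContMDiffOn (Mdl m) (Mdl m) ∞ φ M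
  exists_inverse : ∃ ψ : Spc K → Spc K, MapsTo ψ M M ∧ ContMDiffOn (Mdl m) (Mdl m) ∞ ψ M ∧
    ∀ p ∈ M, ψ (φ p) = p
  boundary : ∀ p ∈ M, p.2.1 = 0 → (φ p).2.1 = 0
  interior : ∀ p ∈ M, 0 < p.2.1 → 0 < (φ p).2.1

theorem IsAdaptedDiffeo.contMDiffAt (hφ : IsAdaptedDiffeo (m := m) M φ) (hM : IsOpen M) {p : Spc K}
    (hp : p ∈ M) : ContMDiffAt (Mdl m) (Mdl m) ∞ φ p :=
  hφ.smooth.contMDiffAt (hM.mem_nhds hp)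

theorem IsAdaptedDiffeo.mdifferentiableAt (hφ : IsAdaptedDiffeo (m := m) M φ) (hM : IsOpen M)
    {p : Spc K} (hp : p ∈ M) : MDifferentiableAt (Mdl m) (Mdl m) φ p :=
  (hφ.contMDiffAt hM hp).mdifferentiableAt (by simp)

/-- The chain rule applied to the left inverse `ψ ∘ φ = id`, which holds near `p` because `M` is
open. -/
theorem IsAdaptedDiffeo.mfderiv_injective (hφ : IsAdaptedDiffeo (m := m) M φ) (hM : IsOpen M)
    {p : Spc K} (hp : p ∈ M) : Function.Injective (mfderiv (Mdl m) (Mdl m) φ p) := by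
  obtain ⟨ψ, -, hs, hl⟩ := hφ.exists_inverse
  have hψ : MDifferentiableAt (Mdl m) (Mdl m) ψ (φ p) :=
    (hs.contMDiffAt (hM.mem_nhds (hφ.mapsTo hp))).mdifferentiableAt (by simp)
  have h := mfderiv_comp p hψ (hφ.mdifferentiableAt hM hp)
  have h2 : (ψ ∘ φ) =ᶠ[𝓝 p] id := (hM.eventually_mem hp).mono fun q hq => hl q hq
  have h3 : ∀ v : TangentSpace (Mdl m) p, (mfderiv (Mdl m) (Mdl m) (ψ ∘ φ) p v :
      ℝ × ℝ × EuclideanSpace ℝ (Fin m)) = v := fun v => by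
    rw [h2.mfderiv_eq, mfderiv_id]; rfl
  rw [h] at h3
  intro v w hvw
  have hv := h3 v
  rw [ContinuousLinearMap.comp_apply, hvw, ← ContinuousLinearMap.comp_apply, h3 w] at hv
  exact hv.symm

/-- The bilinear form given by the components of `g`. -/
theorem dotProduct_metricComp (g : BField m K)
    {q : Spc K} (hq : coordInv e y = q) (u v : Fin (m + 2) → ℝ) :
    u ⬝ᵥ metricComp e g y *ᵥ v
      = g q (mfderiv 𝓘(ℝ, Fin (m + 2) → ℝ) (Mdl m) (coordInv e) y u)
          (mfderiv 𝓘(ℝ, Fin (m + 2) → ℝ) (Mdl m) (coordInv e) y v) := by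
  subst hq
  have hs : ∀ w : Fin (m + 2) → ℝ, mfderiv 𝓘(ℝ, Fin (m + 2) → ℝ) (Mdl m) (coordInv e) y w
      = ∑ μ, w μ • coordVec e y μ := by
    intro w
    have : w = ∑ μ, w μ • (Pi.single μ 1 : Fin (m + 2) → ℝ) := by
      conv_lhs => rw [← Finset.univ_sum_single w]
      exact Finset.sum_congr rfl fun μ _ => by rw [← Pi.single_smul, smul_eq_mul, mul_one]
    conv_lhs => rw [this]
    exact (map_sum _ _ _).trans (Finset.sum_congr rfl fun μ _ => map_smul _ _ _)
  rw [hs u, hs v]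
  simp only [map_sum, map_smul, LinearMap.sum_apply, LinearMap.smul_apply, smul_eq_mul,
    dotProduct, Matrix.mulVec, Finset.mul_sum, metricComp, Matrix.of_apply]
  rw [Finset.sum_comm]
  exact Finset.sum_congr rfl fun _ _ => Finset.sum_congr rfl fun _ _ => by ring

/-- Symmetry is not part of `BField`; it follows from the existence of an orthonormal basis, as does
nondegeneracy in `IsLorentzMetric.eq_zero`. -/
theorem IsLorentzMetric.symm_apply {g : BField m K} (hg : IsLorentzMetric W g) {p : Spc K}
    (hp : p ∈ W) (u v : TangentSpace (Mdl m) p) : g p u v = g p v u := by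
  obtain ⟨b, hb⟩ := hg.lorentzian p hp
  have : g p = (g p).flip := b.ext fun i => b.ext fun j => by
    rw [LinearMap.flip_apply, hb, hb]
    by_cases h : i = j
    · subst h; rfl
    · rw [if_neg h, if_neg (Ne.symm h)]
  conv_lhs => rw [this]
  rfl

theorem IsLorentzMetric.eq_zero {g : BField m K} (hg : IsLorentzMetric W g) {p : Spc K}
    (hp : p ∈ W) {v : TangentSpace (Mdl m) p} (h : ∀ u, g p u v = 0) : v = 0 := by
  obtain ⟨b, hb⟩ := hg.lorentzian p hp
  apply b.repr.injective
  ext i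
  have h1 := h (b i)
  rw [← b.sum_repr v, map_sum, Finset.sum_eq_single i] at h1
  · rw [map_smul, hb, if_pos rfl, smul_eq_mul, mul_eq_zero] at h1
    rw [map_zero, Finsupp.zero_apply]
    refine h1.resolve_right ?_
    split_ifs <;> norm_num
  · intro j _ hj
    rw [map_smul, hb, if_neg (Ne.symm hj), smul_zero]
  · simp

theorem IsLorentzMetric.transpose_metricComp {g : BField m K} (hg : IsLorentzMetric W g)
    (hyW : coordInv e y ∈ W) : (metricComp e g y)ᵀ = metricComp e g y := by
  ext μ ν
  exact hg.symm_apply hyW _ _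

variable [IsManifold (𝓡 m) ∞ K]

/-- The covariance lemmas differentiate the pull-back formulas, so these must hold on a
neighbourhood and not just at `y`. -/
theorem InCharts.eventually (hφ : IsAdaptedDiffeo (m := m) M φ) (hM : IsOpen M) (hW : IsOpen W)
    (hWM : W ⊆ M) (he : e ∈ atlas (EuclideanSpace ℝ (Fin m)) K) (h : InCharts W e e' φ y) :
    ∀ᶠ z in 𝓝 y, InCharts W e e' φ z := by
  have hc : ContinuousAt (coordInv e) y := (contMDiffAt_coordInv he h.ang).continuousAt
  have hcφ : ContinuousAt (fun z => φ (coordInv e z)) y :=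
    ContinuousAt.comp (hφ.contMDiffAt hM (hWM h.mem)).continuousAt hc
  filter_upwards [(isOpen_angular_preimage e).eventually_mem h.ang,
    hc.eventually (hW.eventually_mem h.mem),
    hcφ.eventually ((isOpen_source_preimage e').eventually_mem h.image)] with z h1 h2 h3
  exact ⟨h1, h2, h3⟩

theorem contDiffAt_coordExpr (hφ : IsAdaptedDiffeo (m := m) M φ) (hM : IsOpen M)
    (he : e ∈ atlas (EuclideanSpace ℝ (Fin m)) K) (he' : e' ∈ atlas (EuclideanSpace ℝ (Fin m)) K)
    (h : InCharts M e e' φ y) : ContDiffAt ℝ ∞ (coordExpr e e' φ) y := by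
  rw [← contMDiffAt_iff_contDiffAt]
  exact ContMDiffAt.comp y (contMDiffAt_coordMap he' h.image)
    (ContMDiffAt.comp y (hφ.contMDiffAt hM h.mem) (contMDiffAt_coordInv he h.ang))

theorem jac_coordExpr_mulVec (hφ : IsAdaptedDiffeo (m := m) M φ) (hM : IsOpen M)
    (he : e ∈ atlas (EuclideanSpace ℝ (Fin m)) K) (he' : e' ∈ atlas (EuclideanSpace ℝ (Fin m)) K)
    (h : InCharts M e e' φ y) (v : Fin (m + 2) → ℝ) :
    jac (coordExpr e e' φ) y *ᵥ v
      = mfderiv (Mdl m) 𝓘(ℝ, Fin (m + 2) → ℝ) (coordMap e') (φ (coordInv e y))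
        (mfderiv (Mdl m) (Mdl m) φ (coordInv e y)
          (mfderiv 𝓘(ℝ, Fin (m + 2) → ℝ) (Mdl m) (coordInv e) y v)) := by
  have hi := mdifferentiableAt_coordInv he h.ang
  have hp := hφ.mdifferentiableAt hM h.mem
  have h1 := mfderiv_comp y hp hi
  have h2 := mfderiv_comp (f := φ ∘ coordInv e) y (mdifferentiableAt_coordMap he' h.image)
    (hp.comp y hi)
  rw [h1] at h2
  rw [jac_mulVec, ← mfderiv_eq_fderiv]
  exact congrArg (fun L : (Fin (m + 2) → ℝ) →L[ℝ] Fin (m + 2) → ℝ => L v) h2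

/-- A vector in the kernel of the Jacobian is killed by a composition of three injective
differentials. -/
theorem isUnit_det_jac_coordExpr (hφ : IsAdaptedDiffeo (m := m) M φ) (hM : IsOpen M)
    (he : e ∈ atlas (EuclideanSpace ℝ (Fin m)) K) (he' : e' ∈ atlas (EuclideanSpace ℝ (Fin m)) K)
    (h : InCharts M e e' φ y) : IsUnit (jac (coordExpr e e' φ) y).det := by
  rw [isUnit_iff_ne_zero]
  intro h0
  obtain ⟨v, hv, hv0⟩ := Matrix.exists_mulVec_eq_zero_iff.2 h0
  rw [jac_coordExpr_mulVec hφ hM he he' h] at hv0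
  have h1 := mfderiv_coordInv_mfderiv_coordMap he' h.image (mfderiv (Mdl m) (Mdl m) φ (coordInv e y)
          (mfderiv 𝓘(ℝ, Fin (m + 2) → ℝ) (Mdl m) (coordInv e) y v))
  rw [hv0] at h1
  have h2 : mfderiv 𝓘(ℝ, Fin (m + 2) → ℝ) (Mdl m) (coordInv e) y v = 0 := by
    refine hφ.mfderiv_injective hM h.mem ?_
    rw [map_zero]
    exact h1.symm.trans (ContinuousLinearMap.map_zero (mfderiv 𝓘(ℝ, Fin (m + 2) → ℝ) (Mdl m)
      (coordInv e') (coordMap e' (φ (coordInv e y)))))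
  have h3 := mfderiv_coordMap_mfderiv_coordInv he h.ang v
  rw [h2, map_zero] at h3
  exact hv h3.symm

theorem metricComp_pullbackMetric (hφ : IsAdaptedDiffeo (m := m) M φ) (hM : IsOpen M)
    (he : e ∈ atlas (EuclideanSpace ℝ (Fin m)) K) (he' : e' ∈ atlas (EuclideanSpace ℝ (Fin m)) K)
    (h : InCharts M e e' φ y) (g : BField m K) :
    metricComp e (pullbackMetric φ g) y = pullMat (coordExpr e e' φ) (metricComp e' g) y := by
  apply matrix_ext_dotProduct
  intro u v
  have key : ∀ w : Fin (m + 2) → ℝ,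
      (mfderiv 𝓘(ℝ, Fin (m + 2) → ℝ) (Mdl m) (coordInv e') (coordExpr e e' φ y)
        (jac (coordExpr e e' φ) y *ᵥ w) : ℝ × ℝ × EuclideanSpace ℝ (Fin m))
      = mfderiv (Mdl m) (Mdl m) φ (coordInv e y)
          (mfderiv 𝓘(ℝ, Fin (m + 2) → ℝ) (Mdl m) (coordInv e) y w) := fun w => by
    rw [jac_coordExpr_mulVec hφ hM he he' h]
    exact mfderiv_coordInv_mfderiv_coordMap he' h.image _
  rw [pullMat, ← Matrix.mulVec_mulVec, ← Matrix.mulVec_mulVec, dotProduct_transpose_mulVec,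
    dotProduct_metricComp g (coordInv_coordExpr h), dotProduct_metricComp _ rfl]
  exact (congrArg₂ (fun a b => g (φ (coordInv e y)) a b) (key u) (key v)).symm

theorem vecComp_pushforward (hφ : IsAdaptedDiffeo (m := m) M φ) (hM : IsOpen M)
    (he : e ∈ atlas (EuclideanSpace ℝ (Fin m)) K) (he' : e' ∈ atlas (EuclideanSpace ℝ (Fin m)) K)
    (h : InCharts M e e' φ y) {ξ ζ : VField m K}
    (hζ : ∀ p ∈ M, ζ (φ p) = mfderiv (Mdl m) (Mdl m) φ p (ξ p)) :
    vecComp e' ζ (coordExpr e e' φ y) = jac (coordExpr e e' φ) y *ᵥ vecComp e ξ y := by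
  rw [jac_coordExpr_mulVec hφ hM he he' h, vecComp, coordInv_coordExpr h, hζ _ h.mem]
  congr 2
  have h1 := mfderiv_coordInv_mfderiv_coordMap he (coordInv_mem_source h.ang) (ξ (coordInv e y))
  rw [coordMap_coordInv h.ang] at h1
  exact h1.symm

/-- The components are the fibre part of the tangent map of `coordMap e` applied to the section `ξ`,
a composition of smooth maps. -/
theorem contDiffAt_vecComp (hM : IsOpen M) {ξ : VField m K}
    (hξ : ContMDiffOn (Mdl m) (Mdl m).tangent ∞
      (fun p => (⟨p, ξ p⟩ : TangentBundle (Mdl m) (Spc K))) M)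
    (he : e ∈ atlas (EuclideanSpace ℝ (Fin m)) K) (hy : angular y ∈ e.target)
    (hyM : coordInv e y ∈ M) : ContDiffAt ℝ ∞ (vecComp e ξ) y := by
  have hU := isOpen_source_preimage e
  have h1 : ContMDiffOn (Mdl m) 𝓘(ℝ, Fin (m + 2) → ℝ) ∞ (coordMap e)
      {p : Spc K | p.2.2 ∈ e.source} := fun p hp => (contMDiffAt_coordMap he hp).contMDiffWithinAt
  have : IsManifold (𝓡 m) 1 K := .of_le (n := ∞) (by simp)
  have h2 := h1.contMDiffOn_tangentMapWithin (m := ∞) (by simp) hU.uniqueMDiffOn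
  have h3 : ContMDiffAt 𝓘(ℝ, Fin (m + 2) → ℝ) (Mdl m).tangent ∞
      (fun z => (⟨coordInv e z, ξ (coordInv e z)⟩ : TangentBundle (Mdl m) (Spc K))) y :=
    ContMDiffAt.comp y (hξ.contMDiffAt (hM.mem_nhds hyM)) (contMDiffAt_coordInv he hy)
  have h4 : ContMDiffAt (Mdl m).tangent 𝓘(ℝ, Fin (m + 2) → ℝ).tangent ∞
      (tangentMapWithin (Mdl m) 𝓘(ℝ, Fin (m + 2) → ℝ) (coordMap e) {p : Spc K | p.2.2 ∈ e.source})
      (⟨coordInv e y, ξ (coordInv e y)⟩ : TangentBundle (Mdl m) (Spc K)) := by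
    refine h2.contMDiffAt ((hU.preimage ?_).mem_nhds (coordInv_mem_source hy))
    exact FiberBundle.continuous_proj _ _
  have h5 := ContMDiffAt.comp y h4 h3
  have h6 := ContMDiffAt.comp y
    (contMDiff_snd_tangentBundle_modelSpace (Fin (m + 2) → ℝ) 𝓘(ℝ, Fin (m + 2) → ℝ)).contMDiffAt h5
  rw [contMDiffAt_iff_contDiffAt] at h6
  refine h6.congr_of_eventuallyEq ?_
  filter_upwards [(isOpen_angular_preimage e).eventually_mem hy] with z hz
  simp only [Function.comp, tangentMapWithin, vecComp]
  rw [mfderivWithin_of_isOpen hU (coordInv_mem_source hz)]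

theorem isOpen_coordDomain (hW : IsOpen W) (he : e ∈ atlas (EuclideanSpace ℝ (Fin m)) K) :
    IsOpen (coordDomain e W) := by
  have h : ContinuousOn (coordInv e) {y : Fin (m + 2) → ℝ | angular y ∈ e.target} :=
    fun y hy => (contMDiffAt_coordInv he hy).continuousAt.continuousWithinAt
  exact h.isOpen_inter_preimage (isOpen_angular_preimage e) hW

theorem IsLorentzMetric.contDiffAt {g : BField m K} (hg : IsLorentzMetric W g) (hW : IsOpen W)
    (he : e ∈ atlas (EuclideanSpace ℝ (Fin m)) K) (hy : angular y ∈ e.target)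
    (hyW : coordInv e y ∈ W) (μ ν : Fin (m + 2)) :
    ContDiffAt ℝ ∞ (fun z => metricComp e g z μ ν) y :=
  (hg.smooth e he μ ν).contDiffAt ((isOpen_coordDomain hW he).mem_nhds ⟨hy, hyW⟩)

theorem IsLorentzMetric.isUnit_det_metricComp {g : BField m K} (hg : IsLorentzMetric W g)
    (he : e ∈ atlas (EuclideanSpace ℝ (Fin m)) K) (hy : angular y ∈ e.target)
    (hyW : coordInv e y ∈ W) : IsUnit (metricComp e g y).det := by
  rw [isUnit_iff_ne_zero]
  intro h0
  obtain ⟨v, hv, hv0⟩ := Matrix.exists_mulVec_eq_zero_iff.2 h0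
  have h2 : mfderiv 𝓘(ℝ, Fin (m + 2) → ℝ) (Mdl m) (coordInv e) y v = 0 := by
    refine hg.eq_zero hyW fun u => ?_
    have h3 := dotProduct_metricComp (e := e) (y := y) g rfl
      (mfderiv (Mdl m) 𝓘(ℝ, Fin (m + 2) → ℝ) (coordMap e) (coordInv e y) u) v
    rw [hv0] at h3
    have h5 := (dotProduct_zero (_ : Fin (m + 2) → ℝ)).symm.trans h3
    have h4 := mfderiv_coordInv_mfderiv_coordMap he (coordInv_mem_source hy) u
    rw [coordMap_coordInv hy] at h4
    exact (congrArg (fun w => g (coordInv e y) w _) h4.symm).trans h5.symm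
  have h3 := mfderiv_coordMap_mfderiv_coordInv he hy v
  rw [h2, map_zero] at h3
  exact hv h3.symm

end Transition

/-! ### Two estimates from real analysis -/

/-- A function that vanishes where the `k`-th coordinate does is controlled by it. -/
theorem isBigO_coord_of_vanishing {n : ℕ} {F : (Fin n → ℝ) → ℝ} {y₀ : Fin n → ℝ} {k : Fin n}
    (hF : ContDiffAt ℝ 1 F y₀) (hk : y₀ k = 0) (h : ∀ᶠ y in 𝓝 y₀, y k = 0 → F y = 0) :
    F =O[𝓝 y₀] fun y => y k := by
  obtain ⟨C, t, ht, hC⟩ := hF.exists_lipschitzOnWith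
  -- `y` is compared with its projection to the hyperplane, where `F` vanishes; in the sup norm
  -- their distance is at most `|y k|`.
  have hc : Tendsto (fun y : Fin n → ℝ => Function.update y k 0) (𝓝 y₀) (𝓝 y₀) := by
    have h1 : Continuous fun y : Fin n → ℝ => Function.update y k 0 := by fun_prop
    have h2 := h1.tendsto y₀
    rwa [show Function.update y₀ k 0 = y₀ from by rw [← hk, Function.update_eq_self]] at h2
  refine IsBigO.of_bound C ?_
  filter_upwards [ht, hc ht, hc.eventually h] with y h1 h2 h3
  have h4 := hC.dist_le_mul y h1 _ h2
  rw [h3 (by simp), dist_zero_right] at h4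
  refine h4.trans ?_
  gcongr
  rw [dist_pi_le_iff (norm_nonneg _)]
  intro j
  by_cases hj : j = k
  · subst hj; simp
  · simp [Function.update_of_ne hj]

/-- A scalar solution of a differential inequality `|r'| ≤ C |r|` that vanishes somewhere vanishes
identically. -/
theorem eq_zero_of_local_abs_deriv_le {r r' : ℝ → ℝ} (hr : ∀ s, HasDerivAt r (r' s) s)
    (h : ∀ s₀, r s₀ = 0 → ∃ C : ℝ, ∀ᶠ s in 𝓝 s₀, |r' s| ≤ C * |r s|) {s₀ : ℝ} (h₀ : r s₀ = 0)
    (s : ℝ) : r s = 0 := by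
  have hc : Continuous r := continuous_iff_continuousAt.2 fun s => (hr s).continuousAt
  -- The constant `C` is only local, so Grönwall is applied near each zero: the zero set is open and
  -- closed, and the line is connected.
  have hopen : IsOpen {s | r s = 0} := by
    rw [Metric.isOpen_iff]
    intro a ha
    obtain ⟨C, hC⟩ := h a ha
    obtain ⟨ε, hε, hb⟩ := Metric.eventually_nhds_iff.1 hC
    refine ⟨ε, hε, fun b hab => ?_⟩
    rw [Metric.mem_ball, Real.dist_eq] at hab
    rcases le_total a b with hle | hle
    · refine eq_zero_of_abs_deriv_le_mul_abs_self_of_eq_zero_right (f' := r') (K := C)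
        hc.continuousOn (fun x _ => (hr x).hasDerivWithinAt) ha (fun x hx => hb ?_) b ⟨hle, le_rfl⟩
      rw [Real.dist_eq, abs_of_nonneg (sub_nonneg.2 hx.1)]
      rw [abs_of_nonneg (sub_nonneg.2 hle)] at hab
      linarith [hx.2]
    -- Grönwall runs forward only; times before `a` are reached by reversing time.
    · have hd : ∀ x, HasDerivAt (fun x => r (-x)) (-r' (-x)) x := fun x => by
        have h1 := (hr (-x)).comp x (hasDerivAt_neg x)
        rw [mul_neg, mul_one] at h1
        exact h1
      have := eq_zero_of_abs_deriv_le_mul_abs_self_of_eq_zero_right (f := fun x => r (-x))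
        (f' := fun x => -r' (-x)) (K := C) (a := -a) (b := -b) (hc.comp continuous_neg).continuousOn
        (fun x _ => (hd x).hasDerivWithinAt) (by simpa using ha) (fun x hx => by
          rw [norm_neg]
          refine hb ?_
          rw [abs_of_nonpos (sub_nonpos.2 hle)] at hab
          rw [Real.dist_eq, abs_of_nonpos (by linarith [hx.1])]
          linarith [hx.2]) (-b) ⟨by linarith, le_rfl⟩
      simpa using this
  have := IsClopen.eq_univ ⟨isClosed_eq hc continuous_const, hopen⟩ ⟨s₀, h₀⟩
  exact this.ge (mem_univ s)

/-! ### Flows of fields tangent to the boundary -/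

section Flows

variable {m : ℕ} {K : Type*} [TopologicalSpace K] {M : Set (Spc K)}

theorem tendsto_inside (hM : IsOpen M) {t : ℝ} {σ : K} (h : ((t, 0, σ) : Spc K) ∈ M) :
    Tendsto (fun q : ℝ × K => ((t, q.1, q.2) : Spc K)) (𝓝[>] 0 ×ˢ 𝓝 σ)
      (𝓝[inside M] ((t, 0, σ) : Spc K)) := by
  have h1 : Tendsto (fun q : ℝ × K => ((t, q.1, q.2) : Spc K)) (𝓝[>] 0 ×ˢ 𝓝 σ)
      (𝓝 ((t, 0, σ) : Spc K)) := by
    have h2 : Continuous fun q : ℝ × K => ((t, q.1, q.2) : Spc K) := by fun_prop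
    refine (h2.tendsto (0, σ)).mono_left ?_
    rw [nhds_prod_eq]
    exact Filter.prod_mono nhdsWithin_le_nhds le_rfl
  refine tendsto_nhdsWithin_iff.2 ⟨h1, ?_⟩
  filter_upwards [h1.eventually (hM.eventually_mem h),
    tendsto_fst.eventually (self_mem_nhdsWithin (a := (0 : ℝ)) (s := Ioi 0))] with q h2 h3
  exact ⟨h2, h3⟩

theorem neBot_inside (hM : IsOpen M) {p : Spc K} (hp : p ∈ M) (h0 : p.2.1 = 0) :
    (𝓝[inside M] p).NeBot := by
  obtain ⟨t, ρ, σ⟩ := p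
  obtain rfl : ρ = 0 := h0
  exact (tendsto_inside hM hp).neBot

variable [ChartedSpace (EuclideanSpace ℝ (Fin m)) K]

theorem IsAdaptedDiffeo.id (M : Set (Spc K)) : IsAdaptedDiffeo (m := m) M id where
  mapsTo := mapsTo_id M
  smooth := contMDiffOn_id
  exists_inverse := ⟨_root_.id, mapsTo_id M, contMDiffOn_id, fun _ _ => rfl⟩
  boundary _ _ h := h
  interior _ _ h := h

theorem IsAdaptedDiffeo.comp {φ ψ : Spc K → Spc K} (hφ : IsAdaptedDiffeo (m := m) M φ)
    (hψ : IsAdaptedDiffeo (m := m) M ψ) : IsAdaptedDiffeo (m := m) M (φ ∘ ψ) where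
  mapsTo := hφ.mapsTo.comp hψ.mapsTo
  smooth := hφ.smooth.comp hψ.smooth hψ.mapsTo
  exists_inverse := by
    obtain ⟨φ', h1, h2, h3⟩ := hφ.exists_inverse
    obtain ⟨ψ', h1', h2', h3'⟩ := hψ.exists_inverse
    refine ⟨ψ' ∘ φ', h1'.comp h1, h2'.comp h2 h1, fun p hp => ?_⟩
    simp only [Function.comp]
    rw [h3 _ (hψ.mapsTo hp), h3' _ hp]
  boundary p hp h := hφ.boundary _ (hψ.mapsTo hp) (hψ.boundary p hp h)
  interior p hp h := hφ.interior _ (hψ.mapsTo hp) (hψ.interior p hp h)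

/-- The derivative of `ρ` along a vector field. -/
def rhoRate (ξ : VField m K) (p : Spc K) : ℝ :=
  mfderiv (Mdl m) 𝓘(ℝ, ℝ) (fun q : Spc K => q.2.1) p (ξ p)

theorem hasDerivAt_rho {γ : ℝ → Spc K} {ξ : VField m K} (hγ : IsMIntegralCurve γ ξ) (s : ℝ) :
    HasDerivAt (fun s => (γ s).2.1) (rhoRate ξ (γ s)) s := by
  have h1 : MDifferentiableAt (Mdl m) 𝓘(ℝ, ℝ) (fun q : Spc K => q.2.1) (γ s) :=
    mdifferentiableAt_snd.fst
  have h2 := hasMFDerivAt_iff_hasFDerivAt.1 (h1.hasMFDerivAt.comp s (hγ s))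
  have h3 := (hasFDerivAt_iff_hasDerivAt (𝕜 := ℝ) (F := ℝ)).1 h2
  refine h3.congr_deriv ?_
  change mfderiv (Mdl m) 𝓘(ℝ, ℝ) (fun q : Spc K => q.2.1) (γ s) ((1 : ℝ) • ξ (γ s)) = _
  rw [one_smul]
  rfl

variable [IsManifold (𝓡 m) ∞ K]

theorem vecComp_one {e : OpenPartialHomeomorph K (EuclideanSpace ℝ (Fin m))}
    (he : e ∈ atlas (EuclideanSpace ℝ (Fin m)) K) {p : Spc K} (hp : p.2.2 ∈ e.source)
    (ξ : VField m K) : vecComp e ξ (coordMap e p) 1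
      = rhoRate ξ p := by
  have h1 : MDifferentiableAt 𝓘(ℝ, Fin (m + 2) → ℝ) 𝓘(ℝ, ℝ)
      (ContinuousLinearMap.proj (R := ℝ) (φ := fun _ : Fin (m + 2) => ℝ) 1) (coordMap e p) :=
    (ContinuousLinearMap.differentiableAt _).mdifferentiableAt
  have h2 := mfderiv_comp p h1 (mdifferentiableAt_coordMap he hp)
  rw [mfderiv_eq_fderiv, ContinuousLinearMap.fderiv] at h2
  have h3 := congrArg (fun L : TangentSpace (Mdl m) p →L[ℝ] ℝ => L (ξ p)) h2
  rw [vecComp, coordInv_coordMap hp]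
  exact h3.symm

/-- A vector field whose `ρ` component is `O(ρ)` is tangent to the boundary. -/
theorem vecComp_one_isBigO (hM : IsOpen M) {ξ : VField m K}
    (hs : ContMDiffOn (Mdl m) (Mdl m).tangent ∞
      (fun p => (⟨p, ξ p⟩ : TangentBundle (Mdl m) (Spc K))) M)
    (hξ : BoundaryOrder M (fun e => vecComp e ξ)) {p : Spc K} (hp : p ∈ M) (h0 : p.2.1 = 0) :
    rhoRate ξ =O[𝓝 p] fun q => q.2.1 := by
  set e := chartAt (EuclideanSpace ℝ (Fin m)) p.2.2 with he'
  have he : e ∈ atlas (EuclideanSpace ℝ (Fin m)) K := chart_mem_atlas _ _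
  have hsrc : p.2.2 ∈ e.source := mem_chart_source _ _
  have hcd : ∀ q : Spc K, q ∈ M → q.2.2 ∈ e.source →
      ContDiffAt ℝ ∞ (fun y => vecComp e ξ y 1) (coordMap e q) := fun q hq hqs =>
    contDiffAt_pi.1 (contDiffAt_vecComp hM hs he (by rw [angular_coordMap]; exact e.map_source hqs)
      (by rwa [coordInv_coordMap hqs])) 1
  -- The hypothesis is one-sided, from `ρ > 0`. Continuity carries it to vanishing at `ρ = 0`, and
  -- smoothness across the boundary then gives a two-sided bound, needed because `M` may contain
  -- points with `ρ < 0`.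
  have hzero : ∀ q : Spc K, q ∈ M → q.2.2 ∈ e.source → q.2.1 = 0 →
      vecComp e ξ (coordMap e q) 1 = 0 := by
    intro q hq hqs hq0
    have := neBot_inside hM hq hq0
    have h1 := hξ e he q hq hq0 hqs 1
    simp only [if_pos] at h1
    have h2 : Tendsto (fun p : Spc K => vecComp e ξ (coordMap e p) 1) (𝓝[inside M] q) (𝓝 0) := by
      refine h1.trans_tendsto ?_
      have h3 : Continuous fun p : Spc K => p.2.1 := continuous_fst.comp continuous_snd
      have h4 := h3.tendsto q
      rw [hq0] at h4
      exact h4.mono_left nhdsWithin_le_nhds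
    have h5 : ContinuousAt (fun p : Spc K => vecComp e ξ (coordMap e p) 1) q :=
      ContinuousAt.comp (hcd q hq hqs).continuousAt (contMDiffAt_coordMap he hqs).continuousAt
    exact tendsto_nhds_unique (h5.tendsto.mono_left nhdsWithin_le_nhds) h2
  have hang : angular (coordMap e p) ∈ e.target := by
    rw [angular_coordMap]; exact e.map_source hsrc
  have h1 : (fun y => vecComp e ξ y 1) =O[𝓝 (coordMap e p)] fun y => y 1 := by
    refine isBigO_coord_of_vanishing ((hcd p hp hsrc).of_le (by simp)) h0 ?_
    filter_upwards [(isOpen_angular_preimage e).eventually_mem hang,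
      (isOpen_coordDomain hM he).eventually_mem
        (show coordMap e p ∈ coordDomain e M from ⟨hang, by rwa [coordInv_coordMap hsrc]⟩)]
      with y hy hyM hy0
    have h2 := hzero (coordInv e y) hyM.2 (coordInv_mem_source hy) hy0
    rwa [coordMap_coordInv hy] at h2
  have h2 := h1.comp_tendsto (contMDiffAt_coordMap he hsrc).continuousAt
  refine h2.congr' ?_ (Eventually.of_forall fun q => rfl)
  filter_upwards [(isOpen_source_preimage e).eventually_mem hsrc] with q hq
  exact vecComp_one he hq ξ

/-- Along an integral curve `ρ` satisfies `|ρ'| ≤ C |ρ|` near each of its zeros, so a curve that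
meets the boundary stays in it for all times. The inverse is the flow at time `-s`. -/
theorem IsFlow.isAdaptedDiffeo (hM : IsOpen M) {ξ : VField m K} {φ : ℝ → Spc K → Spc K}
    (hφ : IsFlow M ξ φ)
    (hs : ContMDiffOn (Mdl m) (Mdl m).tangent ∞
      (fun p => (⟨p, ξ p⟩ : TangentBundle (Mdl m) (Spc K))) M)
    (hξ : BoundaryOrder M (fun e => vecComp e ξ)) (s : ℝ) : IsAdaptedDiffeo (m := m) M (φ s) := by
  have hd : ∀ p ∈ M, ∀ s, HasDerivAt (fun s => (φ s p).2.1) (rhoRate ξ (φ s p)) s :=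
    fun p hp s => hasDerivAt_rho (hφ.integralCurve p hp) s
  have hloc : ∀ p ∈ M, ∀ s₀, (φ s₀ p).2.1 = 0 → ∃ C : ℝ, ∀ᶠ s in 𝓝 s₀,
      |rhoRate ξ (φ s p)| ≤ C * |(φ s p).2.1| := by
    intro p hp s₀ h0
    obtain ⟨C, hC⟩ := (vecComp_one_isBigO hM hs hξ (hφ.mapsTo s₀ hp) h0).bound
    exact ⟨C, (hφ.integralCurve p hp).continuous.continuousAt.eventually hC⟩
  have hzero : ∀ p ∈ M, ∀ a b, (φ a p).2.1 = 0 → (φ b p).2.1 = 0 := fun p hp a b ha =>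
    eq_zero_of_local_abs_deriv_le (hd p hp) (hloc p hp) ha b
  have hsm : ∀ s, ContMDiffOn (Mdl m) (Mdl m) ∞ (φ s) M := fun s =>
    hφ.smooth.comp (f := fun p : Spc K => (s, p)) (contMDiffOn_const.prodMk contMDiffOn_id)
      fun p hp => ⟨mem_univ _, hp⟩
  refine ⟨hφ.mapsTo s, hsm s, ⟨φ (-s), hφ.mapsTo (-s), hsm (-s), fun p hp => ?_⟩, ?_, ?_⟩
  · rw [← hφ.add _ _ p hp, neg_add_cancel, hφ.zero p hp]
  · intro p hp h0
    refine hzero p hp 0 s ?_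
    rwa [hφ.zero p hp]
  · intro p hp h0
    have hc : Continuous fun s => (φ s p).2.1 :=
      continuous_iff_continuousAt.2 fun s => (hd p hp s).continuousAt
    -- A curve leaving `ρ > 0` would meet `ρ = 0` by the intermediate value theorem and hence lie in
    -- it at time 0.
    by_contra hneg
    obtain ⟨a, ha⟩ := mem_range_of_exists_le_of_exists_ge hc ⟨s, not_lt.1 hneg⟩
      ⟨0, by rw [hφ.zero p hp]; exact h0.le⟩
    have := hzero p hp a 0 ha
    rw [hφ.zero p hp] at this
    exact h0.ne' this

theorem Generated.isAdaptedDiffeo (hM : IsOpen M) {𝒜 : Submodule ℝ (VField m K)}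
    (h𝒜 : IsLieAlgebraOfFields M 𝒜) (hξ : ∀ ξ ∈ 𝒜, BoundaryOrder M (fun e => vecComp e ξ))
    {φ : Spc K → Spc K} (hφ : Generated M 𝒜 φ) : IsAdaptedDiffeo (m := m) M φ := by
  induction hφ with
  | id => exact .id M
  | comp h1 h2 _ ih => exact (h2.isAdaptedDiffeo hM (h𝒜.smooth _ h1) (hξ _ h1) 1).comp ih

end Flows

/-! ### Boundary orders under a transformation of densities -/

theorem two_le_smooth : (2 : WithTop ℕ∞) ≤ ∞ :=
  WithTop.coe_le_coe.2 (le_top (a := (2 : ℕ∞)))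

theorem contDiffAt_pd {n : ℕ} {f : (Fin n → ℝ) → ℝ} {y : Fin n → ℝ} (hf : ContDiffAt ℝ ∞ f y)
    (μ : Fin n) : ContDiffAt ℝ ∞ (pd μ f) y :=
  (hf.fderiv_right (m := ∞) (by simp)).clm_apply contDiffAt_const

theorem contDiffAt_lieMetric {n : ℕ} {ξ : (Fin n → ℝ) → Fin n → ℝ}
    {g : (Fin n → ℝ) → Matrix (Fin n) (Fin n) ℝ} {y : Fin n → ℝ} (hξ : ContDiffAt ℝ ∞ ξ y)
    (hg : ∀ μ ν, ContDiffAt ℝ ∞ (fun z => g z μ ν) y) (μ ν : Fin n) :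
    ContDiffAt ℝ ∞ (fun z => lieMetric ξ g z μ ν) y := by
  have hc := contDiffAt_pi.1 hξ
  exact ContDiffAt.sum (s := Finset.univ) fun α _ => (((hc α).mul (contDiffAt_pd (hg μ ν) α)).add
    ((hg α ν).mul (contDiffAt_pd (hc α) μ))).add ((hg μ α).mul (contDiffAt_pd (hc α) ν))

theorem contDiffAt_jac {n : ℕ} {Φ : (Fin n → ℝ) → Fin n → ℝ} {y : Fin n → ℝ}
    (hΦ : ContDiffAt ℝ ∞ Φ y) (a μ : Fin n) : ContDiffAt ℝ ∞ (fun z => jac Φ z a μ) y :=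
  contDiffAt_pi.1 ((hΦ.fderiv_right (m := ∞) (by simp)).clm_apply
    (contDiffAt_const (c := (Pi.single μ 1 : Fin n → ℝ)))) a

/-- If `Φ` preserves the surface where the `k`-th coordinate vanishes, then the derivatives of
`Φ^k` along it are controlled by that coordinate. -/
theorem jac_isBigO_coord {n : ℕ} {Φ : (Fin n → ℝ) → Fin n → ℝ} {y₀ : Fin n → ℝ} {k ν : Fin n}
    (hΦ : ContDiffAt ℝ ∞ Φ y₀) (hk : y₀ k = 0) (h : ∀ᶠ y in 𝓝 y₀, y k = 0 → Φ y k = 0)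
    (hν : ν ≠ k) : (fun y => jac Φ y k ν) =O[𝓝 y₀] fun y => y k := by
  refine isBigO_coord_of_vanishing ((contDiffAt_jac hΦ k ν).of_le (by simp)) hk ?_
  have hd : ∀ᶠ y in 𝓝 y₀, DifferentiableAt ℝ Φ y :=
    ((hΦ.of_le (m := 1) (by simp)).eventually (by simp)).mono
      fun y hy => hy.differentiableAt (by simp)
  filter_upwards [h.eventually_nhds, hd] with y hy hdy hyk
  -- As `ν ≠ k`, this line stays in the hyperplane `y k = 0`, where `Φ^k` vanishes identically near
  -- `y`.
  have hline : HasDerivAt (fun s : ℝ => y + s • (Pi.single ν 1 : Fin n → ℝ)) (Pi.single ν 1) 0 := by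
    simpa using ((hasDerivAt_id (0 : ℝ)).smul_const (Pi.single ν 1 : Fin n → ℝ)).const_add y
  have h1 : HasFDerivAt Φ (fderiv ℝ Φ y) (y + (0 : ℝ) • (Pi.single ν 1 : Fin n → ℝ)) := by
    simpa using hdy.hasFDerivAt
  have h2 := (hasDerivAt_pi.1 (h1.comp_hasDerivAt (0 : ℝ) hline)) k
  have h3 : (fun s : ℝ => Φ (y + s • (Pi.single ν 1 : Fin n → ℝ)) k) =ᶠ[𝓝 0] fun _ => 0 := by
    have hc : Tendsto (fun s : ℝ => y + s • (Pi.single ν 1 : Fin n → ℝ)) (𝓝 0) (𝓝 y) := by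
      simpa using hline.continuousAt.tendsto
    filter_upwards [hc.eventually hy] with s hs
    exact hs (by simp [hyk, Pi.single_eq_of_ne (Ne.symm hν)])
  exact h2.unique ((hasDerivAt_const (0 : ℝ) (0 : ℝ)).congr_of_eventuallyEq h3)

/-- The boundary behaviour of a vector density is preserved by a transformation that preserves the
boundary. -/
theorem isBigO_of_density_transform {n : ℕ} {X : Type*} {l : Filter X} {k : Fin n}
    {J : X → Matrix (Fin n) (Fin n) ℝ} {J₀ : Matrix (Fin n) (Fin n) ℝ} {w w' : X → Fin n → ℝ}
    {ρ : X → ℝ} (hρ : Tendsto ρ l (𝓝 0)) (hJ : Tendsto J l (𝓝 J₀)) (hJ₀ : IsUnit J₀.det)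
    (hJk : ∀ ν, ν ≠ k → (fun x => J x k ν) =O[l] ρ) (hJk₀ : ∀ ν, ν ≠ k → J₀ k ν = 0)
    (hw : ∀ μ, (fun x => w x μ) =O[l] fun x => if μ = k then ρ x else 1)
    (hw' : ∀ᶠ x in l, w' x = |(J x).det| • ((J x)⁻¹ *ᵥ w x)) (μ : Fin n) :
    (fun x => w' x μ) =O[l] fun x => if μ = k then ρ x else 1 := by
  have hρ1 : ρ =O[l] fun _ => (1 : ℝ) := hρ.isBigO_one ℝ
  have hent : ∀ a b, Tendsto (fun x => J x a b) l (𝓝 (J₀ a b)) := fun a b =>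
    (tendsto_pi_nhds.1 (tendsto_pi_nhds.1 hJ a)) b
  have hdet : Tendsto (fun x => (J x).det) l (𝓝 J₀.det) :=
    ((continuous_id.matrix_det).tendsto J₀).comp hJ
  have hdet0 : J₀.det ≠ 0 := hJ₀.ne_zero
  have hinv : Tendsto (fun x => (J x)⁻¹) l (𝓝 J₀⁻¹) := by
    simp only [Matrix.inv_def, Ring.inverse_eq_inv']
    exact (hdet.inv₀ hdet0).smul (((continuous_id.matrix_adjugate).tendsto J₀).comp hJ)
  have hw1 : ∀ μ, (fun x => w x μ) =O[l] fun _ => (1 : ℝ) := fun μ => by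
    have := hw μ
    by_cases hμ : μ = k
    · simp only [hμ, if_true] at this ⊢
      exact this.trans hρ1
    · simpa only [hμ, if_false] using this
  have hw1' : ∀ μ, (fun x => w' x μ) =O[l] fun _ => (1 : ℝ) := fun μ => by
    have h1 : (fun x => |(J x).det| * ∑ ν, (J x)⁻¹ μ ν * w x ν) =O[l] fun _ => (1 : ℝ) := by
      have h2 : (fun x => ∑ ν, (J x)⁻¹ μ ν * w x ν) =O[l] fun _ => (1 : ℝ) :=
        IsBigO.fun_sum fun ν _ => by
          exact (((tendsto_pi_nhds.1 (tendsto_pi_nhds.1 hinv μ) ν).isBigO_one ℝ).mul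
            (hw1 ν)).congr_right fun _ => one_mul _
      exact ((hdet.abs.isBigO_one ℝ).mul h2).congr_right fun _ => one_mul _
    refine h1.congr' ?_ EventuallyEq.rfl
    filter_upwards [hw'] with x hx
    rw [hx]; rfl
  by_cases hμ : μ = k
  · subst hμ
    -- Instead of estimating a row of `J⁻¹`, row `k` of `J w' = |det J| w` is solved for the `k`-th
    -- component: the off-diagonal entries of the row are `O(ρ)` and meet bounded components.
    simp only [if_true]
    -- Otherwise the whole `k`-th row of the invertible limit `J₀` would vanish.
    have hkk : J₀ μ μ ≠ 0 := fun h0 => hdet0 <| Matrix.det_eq_zero_of_row_eq_zero μ fun ν => by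
      by_cases h : ν = μ
      · rw [h, h0]
      · exact hJk₀ ν h
    have hwμ : (fun x => w x μ) =O[l] ρ := by simpa using hw μ
    have h1 : (fun x => |(J x).det| * w x μ) =O[l] ρ := by
      exact ((hdet.abs.isBigO_one ℝ).mul hwμ).congr_right fun _ => one_mul _
    have h2 : (fun x => ∑ ν ∈ Finset.univ.erase μ, J x μ ν * w' x ν) =O[l] ρ :=
      IsBigO.fun_sum fun ν hν => by
        exact ((hJk ν (Finset.ne_of_mem_erase hν)).mul (hw1' ν)).congr_right fun _ => mul_one _
    have h3 := ((hent μ μ).inv₀ hkk).isBigO_one ℝ |>.mul (h1.sub h2)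
    simp only [one_mul] at h3
    refine h3.congr' ?_ EventuallyEq.rfl
    filter_upwards [hw', hdet.eventually_ne hdet0, (hent μ μ).eventually_ne hkk] with x hx hx1 hx2
    have h4 : (J x *ᵥ w' x) μ = |(J x).det| * w x μ := by
      rw [hx, Matrix.mulVec_smul, Matrix.mulVec_mulVec,
        Matrix.mul_nonsing_inv _ (isUnit_iff_ne_zero.2 hx1), Matrix.one_mulVec]
      rfl
    have h5 : J x μ μ * w' x μ + ∑ ν ∈ Finset.univ.erase μ, J x μ ν * w' x ν
        = |(J x).det| * w x μ := by
      rw [← h4, Finset.add_sum_erase _ (fun ν => J x μ ν * w' x ν) (Finset.mem_univ μ)]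
      rfl
    rw [← h5]
    field_simp
    ring
  · simpa only [hμ, if_false] using hw1' μ

/-! ### The current of a pulled back metric -/

section Covariance

variable {m : ℕ} {K : Type*} [TopologicalSpace K] [ChartedSpace (EuclideanSpace ℝ (Fin m)) K]
  [IsManifold (𝓡 m) ∞ K] {M : Set (Spc K)} {φ : Spc K → Spc K}
  {e e' : OpenPartialHomeomorph K (EuclideanSpace ℝ (Fin m))} {y : Fin (m + 2) → ℝ}

/-- The components of the pre-symplectic current of a pulled back metric. -/
theorem omegaComp_pullbackMetric (G : ℝ) (hφ : IsAdaptedDiffeo (m := m) M φ) (hM : IsOpen M)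
    (he : e ∈ atlas (EuclideanSpace ℝ (Fin m)) K) (he' : e' ∈ atlas (EuclideanSpace ℝ (Fin m)) K)
    (h : InCharts (inside M) e e' φ y) {g : BField m K} (hg : IsLorentzMetric (inside M) g)
    {η χ η' χ' : VField m K}
    (hη : ContMDiffOn (Mdl m) (Mdl m).tangent ∞
      (fun p => (⟨p, η p⟩ : TangentBundle (Mdl m) (Spc K))) M)
    (hχ : ContMDiffOn (Mdl m) (Mdl m).tangent ∞
      (fun p => (⟨p, χ p⟩ : TangentBundle (Mdl m) (Spc K))) M)
    (hη' : ContMDiffOn (Mdl m) (Mdl m).tangent ∞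
      (fun p => (⟨p, η' p⟩ : TangentBundle (Mdl m) (Spc K))) M)
    (hχ' : ContMDiffOn (Mdl m) (Mdl m).tangent ∞
      (fun p => (⟨p, χ' p⟩ : TangentBundle (Mdl m) (Spc K))) M)
    (hηη' : ∀ p ∈ M, η' (φ p) = mfderiv (Mdl m) (Mdl m) φ p (η p))
    (hχχ' : ∀ p ∈ M, χ' (φ p) = mfderiv (Mdl m) (Mdl m) φ p (χ p)) :
    omegaComp G e (pullbackMetric φ g) η χ y = |(jac (coordExpr e e' φ) y).det| •
      ((jac (coordExpr e e' φ) y)⁻¹ *ᵥ omegaComp G e' g η' χ' (coordExpr e e' φ y)) := by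
  have hin : ∀ z, InCharts (inside M) e e' φ z → InCharts M e e' φ z :=
    fun z hz => ⟨hz.ang, hz.mem.1, hz.image⟩
  have hang : ∀ z, InCharts (inside M) e e' φ z → angular (coordExpr e e' φ z) ∈ e'.target :=
    fun z hz => by rw [coordExpr, angular_coordMap]; exact e'.map_source hz.image
  have hmem : ∀ z, InCharts (inside M) e e' φ z →
      coordInv e' (coordExpr e e' φ z) ∈ inside M := fun z hz => by
    rw [coordInv_coordExpr hz]
    exact ⟨hφ.mapsTo hz.mem.1, hφ.interior _ hz.mem.1 hz.mem.2⟩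
  have hev : ∀ z, InCharts (inside M) e e' φ z → ∀ᶠ x in 𝓝 z, InCharts (inside M) e e' φ x :=
    fun z hz => hz.eventually hφ hM (isOpen_inside hM) (fun p hp => hp.1) he
  have hΦ : ∀ z, InCharts (inside M) e e' φ z → ContDiffAt ℝ ∞ (coordExpr e e' φ) z :=
    fun z hz => contDiffAt_coordExpr hφ hM he he' (hin z hz)
  have hgd : ∀ z, InCharts (inside M) e e' φ z →
      ∀ μ ν, ContDiffAt ℝ ∞ (fun x => metricComp e' g x μ ν) (coordExpr e e' φ z) :=
    fun z hz => hg.contDiffAt (isOpen_inside hM) he' (hang z hz) (hmem z hz)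
  have hgd' : ∀ z, InCharts (inside M) e e' φ z →
      EntryDiffAt (metricComp e' g) (coordExpr e e' φ z) := fun z hz μ ν =>
    (hgd z hz μ ν).differentiableAt (by simp)
  have hg' : ∀ z, InCharts (inside M) e e' φ z →
      metricComp e (pullbackMetric φ g) =ᶠ[𝓝 z] pullMat (coordExpr e e' φ) (metricComp e' g) :=
    fun z hz => (hev z hz).mono fun x hx => metricComp_pullbackMetric hφ hM he he' (hin x hx) g
  -- Equality near `y` is required since the current differentiates the variations; so the
  -- naturality of the Lie derivative is applied at every nearby `z`.
  have hlie : ∀ ξ ξ' : VField m K,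
      ContMDiffOn (Mdl m) (Mdl m).tangent ∞
        (fun p => (⟨p, ξ p⟩ : TangentBundle (Mdl m) (Spc K))) M →
      ContMDiffOn (Mdl m) (Mdl m).tangent ∞
        (fun p => (⟨p, ξ' p⟩ : TangentBundle (Mdl m) (Spc K))) M →
      (∀ p ∈ M, ξ' (φ p) = mfderiv (Mdl m) (Mdl m) φ p (ξ p)) →
      EntryDiffAt (lieMetric (vecComp e' ξ') (metricComp e' g)) (coordExpr e e' φ y) ∧
      lieMetric (vecComp e ξ) (metricComp e (pullbackMetric φ g)) =ᶠ[𝓝 y]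
        pullMat (coordExpr e e' φ) (lieMetric (vecComp e' ξ') (metricComp e' g)) := by
    intro ξ ξ' hξ hξ' hpush
    have hd' : ∀ z, InCharts (inside M) e e' φ z →
        ContDiffAt ℝ ∞ (vecComp e' ξ') (coordExpr e e' φ z) := fun z hz =>
      contDiffAt_vecComp hM hξ' he' (hang z hz) (hmem z hz).1
    refine ⟨fun μ ν => (contDiffAt_lieMetric (hd' y h) (hgd y h) μ ν).differentiableAt (by simp),
      (hev y h).mono fun z hz => ?_⟩
    exact lieMetric_pullMat ((hΦ z hz).of_le two_le_smooth) ((hd' z hz).differentiableAt (by simp))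
      ((contDiffAt_vecComp hM hξ he hz.ang hz.mem.1).differentiableAt (by simp))
      ((hev z hz).mono fun x hx => vecComp_pushforward hφ hM he he' (hin x hx) hpush)
      (hgd' z hz) (hg' z hz)
  obtain ⟨a1, a2⟩ := hlie η η' hη hη' hηη'
  obtain ⟨b1, b2⟩ := hlie χ χ' hχ hχ' hχχ'
  exact jac_mulVec_symplecticCurrent G ((hΦ y h).of_le two_le_smooth)
    (isUnit_det_jac_coordExpr hφ hM he he' (hin y h)) (hgd' y h)
    (hg.transpose_metricComp (hmem y h)) (hg.isUnit_det_metricComp he' (hang y h) (hmem y h))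
    (hg' y h) a1 a2 b1 b2

/-- The boundary behaviour of the pre-symplectic current at `g` is inherited by `φ^* g`. -/
theorem boundaryOrder_omegaComp_pullbackMetric (G : ℝ) (hφ : IsAdaptedDiffeo (m := m) M φ)
    (hM : IsOpen M) {g : BField m K} (hg : IsLorentzMetric (inside M) g)
    {η χ η' χ' : VField m K}
    (hη : ContMDiffOn (Mdl m) (Mdl m).tangent ∞
      (fun p => (⟨p, η p⟩ : TangentBundle (Mdl m) (Spc K))) M)
    (hχ : ContMDiffOn (Mdl m) (Mdl m).tangent ∞
      (fun p => (⟨p, χ p⟩ : TangentBundle (Mdl m) (Spc K))) M)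
    (hη' : ContMDiffOn (Mdl m) (Mdl m).tangent ∞
      (fun p => (⟨p, η' p⟩ : TangentBundle (Mdl m) (Spc K))) M)
    (hχ' : ContMDiffOn (Mdl m) (Mdl m).tangent ∞
      (fun p => (⟨p, χ' p⟩ : TangentBundle (Mdl m) (Spc K))) M)
    (hηη' : ∀ p ∈ M, η' (φ p) = mfderiv (Mdl m) (Mdl m) φ p (η p))
    (hχχ' : ∀ p ∈ M, χ' (φ p) = mfderiv (Mdl m) (Mdl m) φ p (χ p))
    (hω : BoundaryOrder M (fun e => omegaComp G e g η' χ')) :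
    BoundaryOrder M (fun e => omegaComp G e (pullbackMetric φ g) η χ) := by
  intro e he p hp h0 hsrc μ
  set e' := chartAt (EuclideanSpace ℝ (Fin m)) (φ p).2.2 with e'_def
  have he' : e' ∈ atlas (EuclideanSpace ℝ (Fin m)) K := chart_mem_atlas _ _
  have hsrc' : (φ p).2.2 ∈ e'.source := mem_chart_source _ _
  have hin : ∀ q : Spc K, q.2.2 ∈ e.source → ∀ W : Set (Spc K), q ∈ W → (φ q).2.2 ∈ e'.source →
      InCharts W e e' φ (coordMap e q) := fun q hq W hW hq' =>
    ⟨by rw [angular_coordMap]; exact e.map_source hq, by rwa [coordInv_coordMap hq],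
      by rwa [coordInv_coordMap hq]⟩
  have hp' := hin p hsrc M hp hsrc'
  have hΦ := contDiffAt_coordExpr hφ hM he he' hp'
  have hc : ContinuousAt (coordMap e) p := (contMDiffAt_coordMap he hsrc).continuousAt
  have hcW : Tendsto (coordMap e) (𝓝[inside M] p) (𝓝 (coordMap e p)) :=
    hc.tendsto.mono_left nhdsWithin_le_nhds
  have hcφ : ContinuousAt φ p := (hφ.contMDiffAt hM hp).continuousAt
  have hcφW : Tendsto φ (𝓝[inside M] p) (𝓝[inside M] (φ p)) := by
    refine tendsto_nhdsWithin_iff.2 ⟨hcφ.tendsto.mono_left nhdsWithin_le_nhds, ?_⟩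
    filter_upwards [self_mem_nhdsWithin] with q hq
    exact ⟨hφ.mapsTo hq.1, hφ.interior q hq.1 hq.2⟩
  have hvan : ∀ᶠ z in 𝓝 (coordMap e p), z 1 = 0 → coordExpr e e' φ z 1 = 0 := by
    filter_upwards [hp'.eventually hφ hM hM subset_rfl he] with z hz hz0
    exact hφ.boundary _ hz.mem hz0
  have hrow := fun ν (hν : ν ≠ 1) => jac_isBigO_coord hΦ (k := 1) h0 hvan hν
  have hρ : Tendsto (fun q : Spc K => q.2.1) (𝓝[inside M] p) (𝓝 0) := by
    have h3 : Continuous fun q : Spc K => q.2.1 := continuous_fst.comp continuous_snd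
    have h4 := h3.tendsto p
    rw [h0] at h4
    exact h4.mono_left nhdsWithin_le_nhds
  have hev : ∀ᶠ q in 𝓝[inside M] p, q.2.2 ∈ e.source ∧ q ∈ inside M ∧ (φ q).2.2 ∈ e'.source :=
    (((isOpen_source_preimage e).eventually_mem hsrc).filter_mono nhdsWithin_le_nhds).and
      (Filter.Eventually.and self_mem_nhdsWithin
        ((hcφ.eventually ((isOpen_source_preimage e').eventually_mem hsrc')).filter_mono
          nhdsWithin_le_nhds))
  refine isBigO_of_density_transform (k := 1) (J := fun q => jac (coordExpr e e' φ) (coordMap e q))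
    (J₀ := jac (coordExpr e e' φ) (coordMap e p))
    (w := fun q => omegaComp G e' g η' χ' (coordMap e' (φ q))) hρ ?_
    (isUnit_det_jac_coordExpr hφ hM he he' hp') (fun ν hν => (hrow ν hν).comp_tendsto hcW) ?_ ?_ ?_
    μ
  · refine tendsto_pi_nhds.2 fun a => tendsto_pi_nhds.2 fun b => ?_
    exact ((contDiffAt_jac hΦ a b).continuousAt.tendsto).comp hcW
  · intro ν hν
    -- The bound holds on a full neighbourhood and may be evaluated at the boundary point itself,
    -- where it forces the entry to vanish.
    obtain ⟨C, hC⟩ := (hrow ν hν).bound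
    have h1 := hC.self_of_nhds
    rw [show coordMap e p 1 = 0 from h0, norm_zero, mul_zero] at h1
    exact norm_le_zero_iff.1 h1
  · intro ν
    have h1 := (hω e' he' (φ p) (hφ.mapsTo hp) (hφ.boundary p hp h0) hsrc' ν).comp_tendsto hcφW
    refine h1.trans ?_
    by_cases hν : ν = 1
    · simp only [hν, if_true]
      -- The order at `φ p` is expressed in `ρ ∘ φ`; since `φ` preserves the boundary, `ρ ∘ φ =
      -- O(ρ)`.
      have h2 := (isBigO_coord_of_vanishing (k := 1)
        ((contDiffAt_pi.1 hΦ 1).of_le (by simp)) h0 hvan).comp_tendsto hcW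
      refine h2.congr' ?_ EventuallyEq.rfl
      filter_upwards [hev] with q hq
      simp only [Function.comp, coordExpr, coordInv_coordMap hq.1]
      rfl
    · simp only [hν, if_false]
      exact isBigO_refl _ _
  · filter_upwards [hev] with q hq
    have h1 := omegaComp_pullbackMetric G hφ hM he he' (hin q hq.1 _ hq.2.1 hq.2.2) hg hη hχ hη' hχ'
      hηη' hχχ'
    rw [h1, coordExpr, coordInv_coordMap hq.1]

end Covariance

/-! ### The boundary integral -/

/-- The Levi-Civita symbol vanishes on repeated indices. -/
theorem injective_of_leviCivita_ne_zero {n : ℕ} {s : Fin n → Fin n} (h : leviCivita s ≠ 0) :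
    Function.Injective s := by
  intro i j hij
  by_contra hne
  exact h (Matrix.det_zero_of_row_eq hne (by funext k; simp [hij]))

/-- Only the `tρ` components contribute on a surface of constant `t` and `ρ`. -/
theorem surfaceElement_eq_zero {m : ℕ} {μ ν : Fin (m + 2)}
    (h : ¬ ((μ = 0 ∧ ν = 1) ∨ (μ = 1 ∧ ν = 0))) : surfaceElement m μ ν = 0 := by
  refine Finset.sum_eq_zero fun α _ => ?_
  by_contra hne
  obtain ⟨h1, h2⟩ := mul_ne_zero_iff.1 hne
  have hinj := injective_of_leviCivita_ne_zero (div_ne_zero_iff.1 h1).1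
  -- A nonzero determinant forces `α` to exhaust the angular indices, and a nonzero symbol leaves
  -- only 0 and 1 for `μ` and `ν`.
  have hsurj : ∀ j : Fin m, ∃ i, α i = j.succ.succ := by
    intro j
    by_contra hj
    push Not at hj
    exact h2 (Matrix.det_eq_zero_of_column_eq_zero j fun i => by simp [hj i])
  have hμν : μ ≠ ν := fun he => by
    have := @hinj 0 1 he
    simp at this
  have hμ : ∀ j : Fin m, μ ≠ j.succ.succ := fun j hj => by
    obtain ⟨i, hi⟩ := hsurj j
    have := @hinj 0 i.succ.succ (hj.trans hi.symm)
    exact absurd this (Fin.succ_ne_zero _).symm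
  have hν : ∀ j : Fin m, ν ≠ j.succ.succ := fun j hj => by
    obtain ⟨i, hi⟩ := hsurj j
    have := @hinj 1 i.succ.succ (hj.trans hi.symm)
    rw [← Fin.succ_zero_eq_one, Fin.succ_inj] at this
    exact absurd this (Fin.succ_ne_zero _).symm
  have hcase : ∀ κ : Fin (m + 2), (∀ j : Fin m, κ ≠ j.succ.succ) → κ = 0 ∨ κ = 1 := by
    intro κ
    refine Fin.cases (fun _ => Or.inl rfl) (fun κ => ?_) κ
    refine Fin.cases (fun _ => Or.inr rfl) (fun j hj => absurd rfl (hj j)) κ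
  rcases hcase μ hμ with rfl | rfl <;> rcases hcase ν hν with rfl | rfl
  · exact hμν rfl
  · exact h (Or.inl ⟨rfl, rfl⟩)
  · exact h (Or.inr ⟨rfl, rfl⟩)
  · exact hμν rfl

section Boundary

variable {K : Type*} [TopologicalSpace K] {M : Set (Spc K)}

/-- A local bound along a compact part of the boundary is uniform. -/
theorem exists_uniform_bound (hM : IsOpen M) {t : ℝ} {S : Set K} (hS : IsCompact S)
    (hSM : ∀ σ ∈ S, ((t, 0, σ) : Spc K) ∈ M) {F : Spc K → ℝ}
    (hF : ∀ σ ∈ S, F =O[𝓝[inside M] ((t, 0, σ) : Spc K)] fun q : Spc K => q.2.1) :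
    -- One constant and one range of `ρ` serve all of `S`: the property is stable under finite
    -- unions and holds near each point, so compactness suffices.
    ∃ C : ℝ, ∀ᶠ ρ in 𝓝[>] (0 : ℝ), ∀ σ ∈ S, |F (t, ρ, σ)| ≤ C * |ρ| := by
  refine hS.induction_on (p := fun s => ∃ C : ℝ, ∀ᶠ ρ in 𝓝[>] (0 : ℝ), ∀ σ ∈ s,
    |F (t, ρ, σ)| ≤ C * |ρ|) ⟨0, by simp⟩ ?_ ?_ ?_
  · rintro s s' hss ⟨C, hC⟩
    exact ⟨C, hC.mono fun ρ h σ hσ => h σ (hss hσ)⟩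
  · rintro s s' ⟨C, hC⟩ ⟨C', hC'⟩
    refine ⟨max C C', ?_⟩
    filter_upwards [hC, hC'] with ρ h h' σ hσ
    rcases hσ with hσ | hσ
    · exact (h σ hσ).trans (mul_le_mul_of_nonneg_right (le_max_left _ _) (abs_nonneg _))
    · exact (h' σ hσ).trans (mul_le_mul_of_nonneg_right (le_max_right _ _) (abs_nonneg _))
  · intro σ hσ
    obtain ⟨C, hC⟩ := ((hF σ hσ).comp_tendsto (tendsto_inside hM (hSM σ hσ))).bound
    obtain ⟨pa, ha, pb, hb, hab⟩ := eventually_prod_iff.1 hC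
    exact ⟨{τ | pb τ}, mem_nhdsWithin_of_mem_nhds hb, C, ha.mono fun ρ hρ τ hτ => hab hρ hτ⟩

variable {m : ℕ} [ChartedSpace (EuclideanSpace ℝ (Fin m)) K]

/-- By `surfaceElement_eq_zero` only `V^0 W^1 - V^1 W^0` contributes, and each product has exactly
one factor with index 1, of order `ρ`. -/
theorem BoundaryOrder.contraction_isBigO
    {V W : OpenPartialHomeomorph K (EuclideanSpace ℝ (Fin m)) →
      (Fin (m + 2) → ℝ) → Fin (m + 2) → ℝ} (hV : BoundaryOrder M V) (hW : BoundaryOrder M W)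
    {e : OpenPartialHomeomorph K (EuclideanSpace ℝ (Fin m))}
    (he : e ∈ atlas (EuclideanSpace ℝ (Fin m)) K) {p : Spc K} (hp : p ∈ M) (h0 : p.2.1 = 0)
    (hsrc : p.2.2 ∈ e.source) :
    (fun q : Spc K => ∑ μ, ∑ ν, surfaceElement m μ ν *
      ((1 / 2) * (V e (coordMap e q) μ * W e (coordMap e q) ν
        - V e (coordMap e q) ν * W e (coordMap e q) μ)))
      =O[𝓝[inside M] p] fun q : Spc K => q.2.1 := by
  have hne : (0 : Fin (m + 2)) ≠ 1 := Fin.zero_ne_one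
  have hV0 : (fun q : Spc K => V e (coordMap e q) 0) =O[𝓝[inside M] p] fun _ => (1 : ℝ) := by
    simpa only [hne, if_false] using hV e he p hp h0 hsrc 0
  have hV1 : (fun q : Spc K => V e (coordMap e q) 1) =O[𝓝[inside M] p] fun q => q.2.1 := by
    simpa only [if_true] using hV e he p hp h0 hsrc 1
  have hW0 : (fun q : Spc K => W e (coordMap e q) 0) =O[𝓝[inside M] p] fun _ => (1 : ℝ) := by
    simpa only [hne, if_false] using hW e he p hp h0 hsrc 0
  have hW1 : (fun q : Spc K => W e (coordMap e q) 1) =O[𝓝[inside M] p] fun q => q.2.1 := by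
    simpa only [if_true] using hW e he p hp h0 hsrc 1
  have h1 : (fun q : Spc K => V e (coordMap e q) 0 * W e (coordMap e q) 1)
      =O[𝓝[inside M] p] fun q => q.2.1 := (hV0.mul hW1).congr_right fun _ => one_mul _
  have h2 : (fun q : Spc K => V e (coordMap e q) 1 * W e (coordMap e q) 0)
      =O[𝓝[inside M] p] fun q => q.2.1 := (hV1.mul hW0).congr_right fun _ => mul_one _
  refine IsBigO.fun_sum fun μ _ => IsBigO.fun_sum fun ν _ => ?_
  by_cases h : (μ = 0 ∧ ν = 1) ∨ (μ = 1 ∧ ν = 0)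
  · rcases h with ⟨rfl, rfl⟩ | ⟨rfl, rfl⟩
    · exact ((h1.sub h2).const_mul_left _).const_mul_left _
    · exact ((h2.sub h1).const_mul_left _).const_mul_left _
  · simp only [surfaceElement_eq_zero h, zero_mul]
    exact isBigO_zero _ _

/-- The closed support of each weight is a compact set inside its chart, so the local `O(ρ)` bounds
become uniform there and the integral is at most a constant times `ρ`. -/
theorem tendsto_surfaceIntegral [CompactSpace K] (hM : IsOpen M) {G : ℝ} {g : BField m K}
    {ξ η χ : VField m K} (hξ : BoundaryOrder M (fun e => vecComp e ξ))
    (hω : BoundaryOrder M (fun e => omegaComp G e g η χ)) {t : ℝ}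
    (ht : ∀ σ : K, ((t, 0, σ) : Spc K) ∈ M) (P : ChartPartition m K) :
    Tendsto (fun ρ => surfaceIntegral P G g ξ η χ t ρ) (𝓝[>] 0) (𝓝 0) := by
  rw [show 𝓝 (0 : ℝ) = 𝓝 (∑ _i : Fin P.size, (0 : ℝ)) by rw [Finset.sum_const_zero]]
  refine tendsto_finsetSum _ fun i _ => ?_
  set e := P.chart i
  set S := tsupport (P.weight i)
  have hS : IsCompact S := (isClosed_tsupport _).isCompact
  have hSsrc : S ⊆ e.source := P.subordinate i
  obtain ⟨C, hC⟩ := exists_uniform_bound hM hS (fun σ _ => ht σ) fun σ hσ =>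
    hξ.contraction_isBigO hω (P.chart_mem i) (ht σ) rfl (hSsrc hσ)
  have hT : IsCompact (e '' S) := hS.image_of_continuousOn (e.continuousOn.mono hSsrc)
  have hTm : MeasurableSet (e '' S) := hT.isClosed.measurableSet
  have hlim : Tendsto (fun ρ : ℝ => ((volume.restrict e.target).real (e '' S)) • (C * |ρ|))
      (𝓝[>] 0) (𝓝 0) := by
    have h1 : Continuous fun ρ : ℝ => ((volume.restrict e.target).real (e '' S)) • (C * |ρ|) := by
      fun_prop
    have h2 := h1.tendsto 0
    simp only [abs_zero, mul_zero, smul_zero] at h2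
    exact h2.mono_left nhdsWithin_le_nhds
  refine squeeze_zero_norm' ?_ hlim
  filter_upwards [hC] with ρ hρ
  -- The bound is written as the integral of a constant on the compact image of the support; only
  -- this majorant has to be integrable.
  rw [← integral_indicator_const _ hTm]
  refine norm_integral_le_of_norm_le ?_ ?_
  · refine (integrable_indicator_iff hTm).2 (integrableOn_const ?_)
    exact ((Measure.restrict_apply_le _ _).trans_lt hT.measure_lt_top).ne
  · filter_upwards [ae_restrict_mem e.open_target.measurableSet] with x hx
    by_cases hxS : e.symm x ∈ S
    · have hxT : x ∈ e '' S := ⟨e.symm x, hxS, e.right_inv hx⟩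
      rw [indicator_of_mem hxT, norm_mul, Real.norm_of_nonneg (P.weight.nonneg i _)]
      exact (mul_le_of_le_one_left (norm_nonneg _) (P.weight.le_one i _)).trans (hρ _ hxS)
    · have hxT : x ∉ e '' S := by
        rintro ⟨σ, hσ, rfl⟩
        rw [e.left_inv (hSsrc hσ)] at hxS
        exact hxS hσ
      rw [indicator_of_notMem hxT, image_eq_zero_of_notMem_tsupport hxS, zero_mul, norm_zero]

end Boundary

end CovPhase

end

theorem mainTheorem1 {m : ℕ} {K : Type*} [TopologicalSpace K] [T2Space K] [CompactSpace K]
    [ChartedSpace (EuclideanSpace ℝ (Fin m)) K] [IsManifold (𝓡 m) ∞ K]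
    (M : Set (CovPhase.Spc K)) (hM : IsOpen M) (G : ℝ) (hG : 0 < G)
    (gbar : CovPhase.BField m K) (hgbar : CovPhase.IsLorentzMetric (CovPhase.inside M) gbar)
    (𝒜 : Submodule ℝ (CovPhase.VField m K)) (h𝒜 : CovPhase.IsLieAlgebraOfFields M 𝒜)
    (hAd : CovPhase.AdjointInvariant M 𝒜)
    (hsufficient1 : ∀ ξ ∈ 𝒜, CovPhase.BoundaryOrder M (fun e => CovPhase.vecComp e ξ))
    (hsufficient2 : ∀ η ∈ 𝒜, ∀ χ ∈ 𝒜,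
      CovPhase.BoundaryOrder M (fun e => CovPhase.omegaComp G e gbar η χ)) :
    ∀ g ∈ CovPhase.orbit M 𝒜 gbar, CovPhase.IntegrabilityCondition M G 𝒜 g := by
  rintro _ ⟨φ, hφ, rfl⟩ ξ hξ η hη χ hχ t ht P
  -- Only `η` and `χ` are pushed forward, since the current alone depends on the metric; condition 1
  -- applies to `ξ` directly, and condition 2 is used for `η', χ'`.
  obtain ⟨η', hη', hηη'⟩ := hAd φ hφ η hη
  obtain ⟨χ', hχ', hχχ'⟩ := hAd φ hφ χ hχ
  exact CovPhase.tendsto_surfaceIntegral hM (hsufficient1 ξ hξ)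
    (CovPhase.boundaryOrder_omegaComp_pullbackMetric G (hφ.isAdaptedDiffeo hM h𝒜 hsufficient1) hM
      hgbar (h𝒜.smooth η hη) (h𝒜.smooth χ hχ) (h𝒜.smooth η' hη') (h𝒜.smooth χ' hχ') hηη' hχχ'
      (hsufficient2 η' hη' χ' hχ')) ht P
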